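/- Let $n\ge 2$, $1\le k\le n$, and $\mathcal N=\{1,\dots,n\}$. For each $i\in\mathcal N$ let $\delta_i\in(0,1)$, $\alpha_i,\beta_i\ge 0$, and let $f_i,c_i:[0,\infty)\to\mathbb R$ be continuous, twice differentiable on $(0,\infty)$, with $f_i(0)=c_i(0)=0$ and, on $(0,\infty)$, $f_i'>0$, $f_i''\le 0$, $c_i'>0$, $c_i''\ge 0$. Exclude the degenerate case in which all $\beta_i$ are $0$ and exactly one $\alpha_i$ is positive. Put $\tilde f_i=\alpha_i f_i+\beta_i$. Consider the following game. In each period $t=0,1,2,\dots$ until agreement, the agents simultaneously choose efforts $x_{i,t}\ge 0$ at cost $c_i(x_{i,t})$; agent $i$ is recognized as proposer with probability $p_i(\boldsymbol x_t)=\tilde f_i(x_{i,t})/\sum_j\tilde f_j(x_{j,t})$ if the denominator is positive, and $1/n$ otherwise; the proposer proposes a division $s\in\{s\in[0,1]^n:\sum_i s_i=1\}$; the other agents simultaneously vote. If at least $k$ agents, counting the proposer, are in favor, the game ends with division $s$; otherwise the next period begins. All past actions are observed. If the proposal $s$ is approved in period $\tau$, agent $i$ gets $\delta_i^\tau s_i-\sum_{t=0}^\tau\delta_i^t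 c_i(x_{i,t})$; without agreement he gets $-\sum_{t\ge 0}\delta_i^t c_i(x_{i,t})$. Agents maximize expected payoffs; proposals may be randomized (with countable support), efforts and votes are pure. A stationary subgame perfect equilibrium (SSPE) is a subgame perfect equilibrium in which each agent's effort, his (random) proposal, and his vote as a function of the proposer and the proposal do not depend on the history; deviations may be history-dependent. Then there is an SSPE, characterized by efforts $\boldsymbol x=(x_i)$, expected payoffs $\boldsymbol v=(v_i)$ and probabilities $\{\psi_{ij}\}_{i\ne j}$, of the following form. Each agent $i$ exerts effort $x_i$ in each period. If recognized, he draws a random coalition $C\subseteq\mathcal N\setminus\{i\}$ of $k-1$ agents, which almost surely minimizes $\sum_{j\in C}\delta_j v_j$ among all such coalitions and contains $j$ with probability $\psi_{ij}$; he offers $\delta_j v_j$ to each $j\in C$, nothing to the agents outside $C\cup\{i\}$, and keeps the rest. If another agent is recognized, $i$ accepts a proposal $s$ if and only if $s_i\ge\delta_i v_i$. If $k=1$, the equilibrium is unique: every SSPE has the same efforts, proposals and expected payoffs, and, if agents vote as if pivotal (a non-proposer $i$ accepts $s$ if and only if $s_i\ge\delta_i v_i$), also the same votes. -/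

import Mathlib

open scoped NNReal ENNReal

noncomputable section

namespace Bargaining

/-- A division of the dollar among `n` agents: a point of the unit simplex. -/
abbrev Proposal (n : ℕ) : Type := stdSimplex ℝ (Fin n)

/-- The data of the bargaining game with costly recognition: production technologies `f i`, effort
costs `c i` (functions on `[0, ∞)`; their values at negative numbers play no role), multiplicative
biases `α i`, headstarts `β i`, discount factors `δ i`, and the number `k` of votes (the
proposer's included) needed to approve a proposal. -/
structure Game (n : ℕ) where
  f : Fin n → ℝ → ℝ
  c : Fin n → ℝ → ℝ
  α : Fin n → ℝ
  β : Fin n → ℝ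
  δ : Fin n → ℝ
  k : ℕ

/-- A production technology: continuous on `[0, ∞)`, zero at zero, twice differentiable on
`(0, ∞)` with positive first and nonpositive second derivative. -/
def IsTechnology (f : ℝ → ℝ) : Prop :=
  ContinuousOn f (Set.Ici 0) ∧ f 0 = 0 ∧
    ∀ x, 0 < x → DifferentiableAt ℝ f x ∧ DifferentiableAt ℝ (deriv f) x ∧
      0 < deriv f x ∧ deriv (deriv f) x ≤ 0

/-- An effort cost: continuous on `[0, ∞)`, zero at zero, twice differentiable on
`(0, ∞)` with positive first and nonnegative second derivative. -/
def IsEffortCost (c : ℝ → ℝ) : Prop :=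
  ContinuousOn c (Set.Ici 0) ∧ c 0 = 0 ∧
    ∀ x, 0 < x → DifferentiableAt ℝ c x ∧ DifferentiableAt ℝ (deriv c) x ∧
      0 < deriv c x ∧ 0 ≤ deriv (deriv c) x

/-- The publicly observed record of one period: efforts, recognized proposer, proposal, votes. -/
structure Round (n : ℕ) where
  effort : Fin n → ℝ≥0
  proposer : Fin n
  proposal : Proposal n
  votes : Fin n → Bool

/-- A history at the beginning of a period: the record of all past periods, the latest one first. -/
abbrev History (n : ℕ) : Type := List (Round n)

/-- A (history-dependent) strategy of one agent. At the beginning of a period he chooses an effort;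
if recognized, he draws a proposal from a distribution that may depend on the history and on the
current efforts; if somebody else is recognized, he votes on the proposal. -/
structure Strategy (n : ℕ) where
  effort : History n → ℝ≥0
  offer : History n → (Fin n → ℝ≥0) → PMF (Proposal n)
  vote : History n → (Fin n → ℝ≥0) → Fin n → Proposal n → Bool

/-- A strategy profile. -/
abbrev Profile (n : ℕ) : Type := Fin n → Strategy n

/-- A stationary strategy: the effort, the distribution of proposals and the reaction
`vote j s` to the proposal `s` of agent `j` do not depend on the history. -/
structure StationaryStrategy (n : ℕ) where
  effort : ℝ≥0
  offer : PMF (Proposal n)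
  vote : Fin n → Proposal n → Bool

/-- A stationary strategy, as a strategy of the dynamic game. -/
def StationaryStrategy.toStrategy {n : ℕ} (a : StationaryStrategy n) : Strategy n where
  effort := fun _ => a.effort
  offer := fun _ _ => a.offer
  vote := fun _ _ j s => a.vote j s

namespace Game

variable {n : ℕ} (G : Game n)

/-- The impact function `α i * f i + β i`. -/
def impact (i : Fin n) (x : ℝ≥0) : ℝ := G.α i * G.f i x + G.β i

/-- The probability that agent `i` is recognized as the proposer, given the effort profile. -/
def recognition (x : Fin n → ℝ≥0) (i : Fin n) : ℝ :=
  if 0 < ∑ j, G.impact j (x j) then G.impact i (x i) / ∑ j, G.impact j (x j) else 1 / (n : ℝ)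

/-- A proposal is approved if at least `k` agents are in favor of it; the proposer `j` counts as
being in favor of his own proposal. -/
def Approved (j : Fin n) (votes : Fin n → Bool) : Prop :=
  G.k ≤ (Finset.univ.filter fun l : Fin n => l = j ∨ votes l = true).card

/-- The lists of rounds after which the game is still going on: all proposals were rejected. -/
def IsHistory (h : History n) : Prop := ∀ r ∈ h, ¬ G.Approved r.proposer r.votes

/- Expected discounted sums along the play of a profile `σ`.

A nonnegative stream is given by `share s`, received when the proposal `s` is approved, and
`flow x`, received in every period in which agent `i` exerts effort `x`. Both are discounted with
the discount factor of agent `i`. The three functions below compute the expectation, measured in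
units of the current period, from each kind of node of a period, if `W` is the expectation at the
beginning of the next period. -/

open Classical in
/-- From the node at which the agents vote on the proposal `s` of agent `j`. -/
def votingStep (σ : Profile n) (i : Fin n) (share : Proposal n → ℝ≥0∞) (W : History n → ℝ≥0∞)
    (h : History n) (x : Fin n → ℝ≥0) (j : Fin n) (s : Proposal n) : ℝ≥0∞ :=
  if G.Approved j (fun l => (σ l).vote h x j s) then share s
  else ENNReal.ofReal (G.δ i) * W (⟨x, j, s, fun l => (σ l).vote h x j s⟩ :: h)

/-- From the node at which agent `j` makes a proposal. -/
def proposalStep (σ : Profile n) (i : Fin n) (share : Proposal n → ℝ≥0∞) (W : History n → ℝ≥0∞)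
    (h : History n) (x : Fin n → ℝ≥0) (j : Fin n) : ℝ≥0∞ :=
  ∑' s : Proposal n, (σ j).offer h x s * G.votingStep σ i share W h x j s

/-- From the beginning of a period. -/
def effortStep (σ : Profile n) (i : Fin n) (share : Proposal n → ℝ≥0∞) (flow : ℝ≥0 → ℝ≥0∞)
    (W : History n → ℝ≥0∞) (h : History n) : ℝ≥0∞ :=
  flow ((σ i).effort h) +
    ∑ j, ENNReal.ofReal (G.recognition (fun l => (σ l).effort h) j) *
      G.proposalStep σ i share W h (fun l => (σ l).effort h) j

/-- The expected discounted sum over the infinite horizon, from the beginning of a period: the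
supremum, which is also the limit, of the expected sums over the next `T` periods. -/
def total (σ : Profile n) (i : Fin n) (share : Proposal n → ℝ≥0∞) (flow : ℝ≥0 → ℝ≥0∞)
    (h : History n) : ℝ≥0∞ :=
  ⨆ T : ℕ, (G.effortStep σ i share flow)^[T] (fun _ => 0) h

/-- The stream of gross payoffs of agent `i`: his share of the dollar. -/
def shareOf (i : Fin n) (s : Proposal n) : ℝ≥0∞ := ENNReal.ofReal ((s : Fin n → ℝ) i)

/-- The stream of effort costs of agent `i`. -/
def costOf (i : Fin n) (x : ℝ≥0) : ℝ≥0∞ := ENNReal.ofReal (G.c i x)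

/-- Expected discounted share of agent `i` from the beginning of a period on. -/
def gross (σ : Profile n) (i : Fin n) (h : History n) : ℝ≥0∞ :=
  G.total σ i (shareOf i) (fun _ => 0) h

/-- Expected discounted effort cost of agent `i` from the beginning of a period on (it may be
infinite). -/
def cost (σ : Profile n) (i : Fin n) (h : History n) : ℝ≥0∞ :=
  G.total σ i (fun _ => 0) (G.costOf i) h

/-- Expected payoff of agent `i` in the subgame that starts at the beginning of a period. -/
def payoff (σ : Profile n) (i : Fin n) (h : History n) : EReal :=
  (G.gross σ i h : EReal) - (G.cost σ i h : EReal)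

/-- Expected payoff of agent `i` in the subgame in which, after efforts `x`, agent `j` has been
recognized and makes a proposal (the current effort cost is sunk). -/
def payoffProposal (σ : Profile n) (i : Fin n) (h : History n) (x : Fin n → ℝ≥0) (j : Fin n) :
    EReal :=
  (G.proposalStep σ i (shareOf i) (G.gross σ i) h x j : EReal) -
    (G.proposalStep σ i (fun _ => 0) (G.cost σ i) h x j : EReal)

/-- Expected payoff of agent `i` in the subgame in which the agents vote on the proposal `s` of
agent `j`. -/
def payoffVoting (σ : Profile n) (i : Fin n) (h : History n) (x : Fin n → ℝ≥0) (j : Fin n)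
    (s : Proposal n) : EReal :=
  (G.votingStep σ i (shareOf i) (G.gross σ i) h x j s : EReal) -
    (G.votingStep σ i (fun _ => 0) (G.cost σ i) h x j s : EReal)

/-- Subgame perfect equilibrium: in no subgame does any agent gain by switching, alone, to any
other strategy. -/
def IsSPE (σ : Profile n) : Prop :=
  ∀ (i : Fin n) (τ : Strategy n) (h : History n), G.IsHistory h →
    G.payoff (Function.update σ i τ) i h ≤ G.payoff σ i h ∧
    (∀ x j, G.payoffProposal (Function.update σ i τ) i h x j ≤ G.payoffProposal σ i h x j) ∧
    (∀ x j s, G.payoffVoting (Function.update σ i τ) i h x j s ≤ G.payoffVoting σ i h x j s)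

/-- A stationary subgame perfect equilibrium: a profile of stationary strategies that is a subgame
perfect equilibrium (no stationarity is required of deviations). -/
def IsSSPE (σ : Fin n → StationaryStrategy n) : Prop :=
  G.IsSPE (fun i => (σ i).toStrategy)

/-- Expected payoff of agent `i` in the whole game under a stationary profile. -/
def stationaryPayoff (σ : Fin n → StationaryStrategy n) (i : Fin n) : EReal :=
  G.payoff (fun l => (σ l).toStrategy) i []

/-- Voting as if pivotal, if the agents' expected payoffs are `v`: an agent who is not the proposer
accepts exactly when his share is at least his discounted continuation value. -/
def VotesAsIfPivotal (σ : Fin n → StationaryStrategy n) (v : Fin n → ℝ) : Prop :=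
  ∀ i j, j ≠ i → ∀ s : Proposal n,
    (σ i).vote j s = true ↔ G.δ i * v i ≤ (s : Fin n → ℝ) i

/-- `C` is a least costly coalition of `k - 1` agents other than `i`, if the vote of agent `j` is
bought at the price `δ j * v j`. -/
def IsLeastCostCoalition (v : Fin n → ℝ) (i : Fin n) (C : Finset (Fin n)) : Prop :=
  i ∉ C ∧ C.card + 1 = G.k ∧
    ∀ C' : Finset (Fin n), i ∉ C' → C'.card + 1 = G.k →
      ∑ j ∈ C, G.δ j * v j ≤ ∑ j ∈ C', G.δ j * v j

/-- The division by which proposer `i` gives `δ j * v j` to each member `j` of the coalition `C`,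
nothing to the other agents, and keeps the rest. -/
def coalitionOffer (v : Fin n → ℝ) (i : Fin n) (C : Finset (Fin n)) : Fin n → ℝ :=
  fun l => if l = i then 1 - ∑ j ∈ C, G.δ j * v j else if l ∈ C then G.δ l * v l else 0

end Game

end Bargaining

end

/-! ### Integrals of determinants of perturbations of the identity -/

section
open MeasureTheory Metric Set

/-! Stationarity reduces the game to a single period. Given continuation values `v`, the vote of `j`
costs `δ j * v j`, a proposer buys the `k - 1` cheapest votes, agreement is immediate, and efforts
form a contest in which `i` competes for the difference between his share as proposer and his share
as responder. An equilibrium is thus a triple `(x, v, q)`, with `q i` a mixture over coalitions,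
such that efforts are mutual best replies, `v` is the vector of resulting payoffs, and each `q i`
charges only least costly coalitions (`IsEquilibriumData`).

Existence: such a triple solves a variational inequality on a compact convex set
(`exists_variationalInequality`, deduced from Brouwer's theorem, which is proved by the
Milnor-Rogers volume argument). The field consists of the scaled marginal loss from effort, the
difference between `v` and the net payoffs, and the coalition prices. The price block says that `q`
minimizes price. In the value block the net payoffs are themselves an admissible test point, which
forces `v` to equal them. The effort block gives first-order conditions, which suffice by
`effort_optimal`: own effort changes the payoff only through total output, and the cost of output is
convex.

The obstacle is the discontinuity of recognition at zero output. Total output is therefore kept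
above a small `s`. As `δ < 1`, proposing is worth at least `η` more than responding, so two agents
who can compete never let output fall to `s` (`lt_sum_output`); positive headstarts make the bound
automatic. If impacts vanish identically, recognition is uniform and can be generated by equal
headstarts.

Verification: against any history-dependent deviation, the bound "gross payoff at most `v i` plus
cost" passes backwards through a period, hence to every finite horizon and to the supremum
(`gross_le`).

Uniqueness for `k = 1`: every proposal passes, so proposers keep everything and efforts are a Nash
equilibrium of a contest for a prize of one. Two such equilibria are compared through their total
outputs (`IsContestEquilibrium.eq_of_sum_le`). -/

theorem exists_polynomial_integral_det {E : Type*} [NormedAddCommGroup E] [NormedSpace ℝ E]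
    [FiniteDimensional ℝ E] [MeasurableSpace E] [BorelSpace E] (μ : Measure E)
    [IsFiniteMeasureOnCompacts μ] {K s : Set E} (hK : IsCompact K) (hs : s ⊆ K)
    {A : E → E →L[ℝ] E} (hA : ContinuousOn A K) :
    ∃ p : Polynomial ℝ, ∀ t : ℝ,
      ∫ x in s, (ContinuousLinearMap.id ℝ E + t • A x).det ∂μ = p.eval t := by
  classical
  let ι := Fin (Module.finrank ℝ E)
  let b : Module.Basis ι ℝ E := Module.finBasis ℝ E
  let m : E → Matrix ι ι ℝ := fun x => LinearMap.toMatrix b b (A x)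
  have hm : ∀ i j, ContinuousOn (fun x => m x i j) K := by
    intro i j
    have : (fun x => m x i j) = fun x => b.coord i (A x (b j)) := by
      ext x; simp [m, LinearMap.toMatrix_apply]
    rw [this]
    exact (LinearMap.continuous_of_finiteDimensional (b.coord i)).comp_continuousOn
      (hA.clm_apply continuousOn_const)
  let cf : Equiv.Perm ι → Finset ι → E → ℝ := fun τ u x =>
    (Equiv.Perm.sign τ : ℤ) *
      ((∏ i ∈ u, (1 : Matrix ι ι ℝ) (τ i) i) * ∏ i ∈ Finset.univ \ u, m x (τ i) i)
  have hcf : ∀ τ u, IntegrableOn (cf τ u) s μ := by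
    intro τ u
    refine IntegrableOn.mono_set (ContinuousOn.integrableOn_compact hK ?_) hs
    have := fun i => hm (τ i) i
    fun_prop
  -- Leibniz formula, each product expanded over the set `u` of indices at which the identity entry
  -- is taken; the other indices contribute the power of `t`.
  have hdet : ∀ t x, (ContinuousLinearMap.id ℝ _ + t • A x).det =
      ∑ τ : Equiv.Perm ι, ∑ u ∈ (Finset.univ : Finset ι).powerset,
        t ^ (Finset.univ \ u).card * cf τ u x := by
    intro t x
    rw [ContinuousLinearMap.det, ← LinearMap.det_toMatrix b]
    have : LinearMap.toMatrix b b
        ((ContinuousLinearMap.id ℝ _ + t • A x : _ →L[ℝ] _) : _ →ₗ[ℝ] _) = 1 + t • m x := by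
      simp [m]
    rw [this, Matrix.det_apply']
    refine Finset.sum_congr rfl fun τ _ => ?_
    simp only [Matrix.add_apply, Matrix.smul_apply, smul_eq_mul]
    rw [Finset.prod_add, Finset.mul_sum]
    refine Finset.sum_congr rfl fun u _ => ?_
    rw [Finset.prod_mul_distrib, Finset.prod_const]
    simp only [cf]; ring
  refine ⟨∑ τ : Equiv.Perm ι, ∑ u ∈ (Finset.univ : Finset ι).powerset,
        Polynomial.C (∫ x in s, cf τ u x ∂μ) * Polynomial.X ^ (Finset.univ \ u).card, fun t => ?_⟩
  simp_rw [hdet]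
  rw [integral_finsetSum]
  · simp only [Polynomial.eval_finsetSum]
    refine Finset.sum_congr rfl fun τ _ => ?_
    rw [integral_finsetSum]
    · refine Finset.sum_congr rfl fun u _ => ?_
      rw [integral_const_mul, Polynomial.eval_mul, Polynomial.eval_C, Polynomial.eval_pow,
        Polynomial.eval_X, mul_comm]
    · exact fun u _ => (hcf τ u).const_mul _
  · exact fun τ _ => integrable_finsetSum _ fun u _ => (hcf τ u).const_mul _

/-- The determinant is continuous along the segment from the identity, where it is 1, and cannot
vanish on it: a kernel vector would satisfy `‖x‖ ≤ u * ‖A‖ * ‖x‖ < ‖x‖`. -/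
theorem det_id_add_smul_pos {E : Type*} [NormedAddCommGroup E] [NormedSpace ℝ E]
    [FiniteDimensional ℝ E] (A : E →L[ℝ] E) {t : ℝ} (ht : 0 ≤ t) (h : t * ‖A‖ < 1) :
    0 < (ContinuousLinearMap.id ℝ E + t • A).det := by
  have hne : ∀ u ∈ Icc 0 t, (ContinuousLinearMap.id ℝ E + u • A).det ≠ 0 := by
    intro u hu h0
    rw [ContinuousLinearMap.det] at h0
    obtain ⟨x, hx, hx0⟩ := (Submodule.ne_bot_iff _).1 (LinearMap.bot_lt_ker_of_det_eq_zero h0).ne'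
    have hx' : x + u • A x = 0 := by simpa using hx
    have h1 : ‖x‖ ≤ u * (‖A‖ * ‖x‖) := by
      have : x = - (u • A x) := eq_neg_of_add_eq_zero_left hx'
      calc ‖x‖ = ‖u • A x‖ := by conv_lhs => rw [this, norm_neg]
        _ = u * ‖A x‖ := by rw [norm_smul, Real.norm_of_nonneg hu.1]
        _ ≤ _ := mul_le_mul_of_nonneg_left (A.le_opNorm x) hu.1
    have h2 : u * ‖A‖ < 1 := (mul_le_mul_of_nonneg_right hu.2 (norm_nonneg _)).trans_lt h
    have h3 : 0 < ‖x‖ := norm_pos_iff.2 hx0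
    nlinarith
  by_contra hneg
  have hcont : ContinuousOn (fun u : ℝ => (ContinuousLinearMap.id ℝ E + u • A).det) (Icc 0 t) := by
    have : Continuous (fun u : ℝ => (ContinuousLinearMap.id ℝ E + u • A).det) :=
      ContinuousLinearMap.continuous_det.comp (by fun_prop)
    exact this.continuousOn
  obtain ⟨u, hu, hu0⟩ := intermediate_value_Icc' ht hcont
    (show (0:ℝ) ∈ Icc _ _ from ⟨not_lt.1 hneg, by simp [ContinuousLinearMap.det]⟩)
  exact hne u hu hu0

end

/-! ### Brouwer's theorem and variational inequalities -/

section
open MeasureTheory Metric Set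
open scoped NNReal

/-- A Lipschitz map on the unit ball that vanishes on the sphere stays Lipschitz when it is
extended by zero. -/
theorem lipschitzWith_indicator_closedBall {E F : Type*} [NormedAddCommGroup E] [NormedSpace ℝ E]
    [NormedAddCommGroup F] {g : E → F} {C : ℝ≥0} (hg : LipschitzOnWith C g (closedBall 0 1))
    (h0 : ∀ x ∈ sphere (0 : E) 1, g x = 0) : LipschitzWith C ((closedBall 0 1).indicator g) := by
  have key : ∀ x ∈ closedBall (0 : E) 1, ∀ y ∉ closedBall (0 : E) 1, ‖g x‖ ≤ C * ‖x - y‖ := by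
    intro x hx y hy
    -- The segment from `x` to `y` crosses the sphere, where `g` vanishes, at distance at most `‖x -
    -- y‖` from `x`.
    have hcont : ContinuousOn (fun t : ℝ => ‖x + t • (y - x)‖) (Icc 0 1) := by fun_prop
    obtain ⟨t, ht, ht1⟩ := intermediate_value_Icc zero_le_one hcont
      (show (1 : ℝ) ∈ Icc _ _ from ⟨by simpa using hx, by simp at hy ⊢; exact hy.le⟩)
    have hz : x + t • (y - x) ∈ sphere (0 : E) 1 := by simpa using ht1
    have := hg.norm_sub_le hx (sphere_subset_closedBall hz)
    rw [h0 _ hz, sub_zero] at this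
    refine this.trans (mul_le_mul_of_nonneg_left ?_ C.2)
    rw [sub_add_cancel_left, norm_neg, norm_smul, Real.norm_of_nonneg ht.1, norm_sub_rev y x]
    exact mul_le_of_le_one_left (norm_nonneg _) ht.2
  refine LipschitzWith.of_dist_le_mul fun x y => ?_
  rw [dist_eq_norm, dist_eq_norm]
  by_cases hx : x ∈ closedBall (0 : E) 1 <;> by_cases hy : y ∈ closedBall (0 : E) 1
  · rw [indicator_of_mem hx, indicator_of_mem hy]; exact hg.norm_sub_le hx hy
  · rw [indicator_of_mem hx, indicator_of_notMem hy, sub_zero]; exact key x hx y hy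
  · rw [indicator_of_notMem hx, indicator_of_mem hy, zero_sub, norm_neg, norm_sub_rev]
    exact key y hy x hx
  · rw [indicator_of_notMem hx, indicator_of_notMem hy, sub_zero, norm_zero]; positivity

theorem bijective_id_add_smul {E : Type*} [NormedAddCommGroup E] [NormedSpace ℝ E] [CompleteSpace E]
    {g : E → E} {C : ℝ≥0} (hg : LipschitzWith C g) {t : ℝ≥0} (ht : t * C < 1) :
    Function.Bijective fun x => x + (t : ℝ) • g x := by
  have happ : ApproximatesLinearOn (fun x => x + (t : ℝ) • g x)
      (ContinuousLinearEquiv.refl ℝ E : E →L[ℝ] E) univ (t * C) := by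
    intro x _ y _
    have : x + (t : ℝ) • g x - (y + (t : ℝ) • g y) - (x - y) = (t : ℝ) • (g x - g y) := by
      rw [smul_sub]; abel
    simp only [ContinuousLinearEquiv.coe_refl, ContinuousLinearMap.coe_id', id_eq, this,
      norm_smul, NNReal.coe_mul, mul_assoc]
    rw [Real.norm_of_nonneg t.coe_nonneg]
    exact mul_le_mul_of_nonneg_left (hg.norm_sub_le x y) t.2
  have hc : Subsingleton E ∨
      t * C < ‖((ContinuousLinearEquiv.refl ℝ E).symm : E →L[ℝ] E)‖₊⁻¹ := by
    rcases subsingleton_or_nontrivial E with h | h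
    · exact Or.inl h
    · right
      have : ‖((ContinuousLinearEquiv.refl ℝ E).symm : E →L[ℝ] E)‖₊ = 1 := by
        rw [← NNReal.coe_inj]; exact ContinuousLinearMap.norm_id
      rw [this, inv_one]; exact ht
  exact ⟨injOn_univ.1 (happ.injOn hc), happ.surjective hc⟩

/-- There is no continuously differentiable retraction of the closed unit ball onto the sphere. -/
theorem no_smooth_retraction {E : Type*} [NormedAddCommGroup E] [InnerProductSpace ℝ E]
    [FiniteDimensional ℝ E] {U : Set (E)} (hU : IsOpen U)
    (hBU : closedBall 0 1 ⊆ U) {r : E → E}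
    (hr : ContDiffOn ℝ 1 r U) (hr1 : ∀ x ∈ closedBall (0 : E) 1, ‖r x‖ = 1)
    (hrs : ∀ x ∈ sphere (0 : E) 1, r x = x) : False := by
  borelize E
  let μ : Measure E := Measure.addHaar
  let g : E → E := fun x => r x - x
  have hgC : ContDiffOn ℝ 1 g U := hr.sub contDiffOn_id
  obtain ⟨C, hC⟩ := (hgC.mono hBU).exists_lipschitzOnWith one_ne_zero (convex_closedBall 0 1)
    (isCompact_closedBall 0 1)
  have hg0 : ∀ x ∈ sphere (0 : E) 1, g x = 0 := fun x hx => by simp [g, hrs x hx]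
  have hlip := lipschitzWith_indicator_closedBall hC hg0
  have hderiv : ∀ x ∈ U, HasFDerivAt g (fderiv ℝ g x) x := fun x hx =>
    ((hgC.differentiableOn one_ne_zero).differentiableAt (hU.mem_nhds hx)).hasFDerivAt
  have hrderiv : ∀ x ∈ U, HasFDerivAt r (ContinuousLinearMap.id ℝ E + fderiv ℝ g x) x := by
    intro x hx
    have := (hasFDerivAt_id x).add (hderiv x hx)
    refine this.congr_of_eventuallyEq (.of_forall fun y => ?_)
    simp [g]
  have hcontD : ContinuousOn (fderiv ℝ g) (closedBall 0 1) :=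
    (hgC.continuousOn_fderiv_of_isOpen hU le_rfl).mono hBU
  obtain ⟨p, hp⟩ := exists_polynomial_integral_det μ (isCompact_closedBall (0 : E) 1)
    (ball_subset_closedBall) hcontD
  have hbound : ∀ x ∈ ball (0 : E) 1, ‖fderiv ℝ g x‖ ≤ C := fun x hx =>
    (hderiv x (hBU (ball_subset_closedBall hx))).le_of_lipschitzOn
      (Filter.mem_of_superset (isOpen_ball.mem_nhds hx) ball_subset_closedBall) hC
  -- the μ of the image of the ball does not depend on small parameters
  have hsmall : ∀ t : ℝ≥0, t * C < 1 → p.eval (t : ℝ) = μ.real (ball (0 : E) 1) := by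
    intro t ht
    have hbij := bijective_id_add_smul hlip ht
    set F : E → E := fun x => x + (t : ℝ) • (closedBall 0 1).indicator g x with hF
    have hFc : ∀ x ∈ (ball (0 : E) 1)ᶜ, F x = x := by
      intro x hx
      by_cases hx1 : x ∈ closedBall (0 : E) 1
      · have : x ∈ sphere (0 : E) 1 := by
          simp at hx hx1 ⊢; exact le_antisymm hx1 hx
        simp [hF, indicator_of_mem hx1, hg0 x this]
      · simp [hF, indicator_of_notMem hx1]
    -- `F` is a bijection that fixes every point outside the open ball, so it permutes the ball.
    have himage : F '' ball 0 1 = ball 0 1 := by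
      have h1 : F '' (ball 0 1)ᶜ = (ball 0 1)ᶜ := by
        conv_rhs => rw [← image_id (ball (0 : E) 1)ᶜ]
        exact image_congr hFc
      rw [image_compl_eq hbij] at h1
      exact compl_injective h1
    have hFd : ∀ x ∈ ball (0 : E) 1, HasFDerivWithinAt F
        (ContinuousLinearMap.id ℝ E + (t : ℝ) • fderiv ℝ g x) (ball 0 1) x := by
      intro x hx
      have h1 := (hasFDerivAt_id x).add
        ((hderiv x (hBU (ball_subset_closedBall hx))).const_smul (t : ℝ))
      refine h1.hasFDerivWithinAt.congr (fun y hy => ?_) ?_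
      · simp [hF, indicator_of_mem (ball_subset_closedBall hy)]
      · simp [hF, indicator_of_mem (ball_subset_closedBall hx)]
    have h2 := integral_image_eq_integral_abs_det_fderiv_smul μ measurableSet_ball hFd
      hbij.1.injOn (fun _ => (1 : ℝ))
    rw [himage] at h2
    rw [← hp]
    simp only [integral_const, smul_eq_mul, mul_one, measureReal_restrict_apply_univ] at h2
    rw [h2]
    refine setIntegral_congr_fun measurableSet_ball fun x hx => ?_
    rw [abs_of_pos]
    refine det_id_add_smul_pos _ t.2 (lt_of_le_of_lt
      (mul_le_mul_of_nonneg_left (hbound x hx) t.2) ?_)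
    exact_mod_cast ht
  -- The polynomial is constant on an interval, hence everywhere; this carries the volume identity
  -- from small `t` to `t = 1`.
  have hpc : p = Polynomial.C (μ.real (ball (0 : E) 1)) := by
    refine Polynomial.eq_of_infinite_eval_eq _ _ ?_
    have hinf : (Icc (0 : ℝ) (1 / (C + 1) / 2)).Infinite := Icc_infinite (by positivity)
    refine hinf.mono fun t ht => ?_
    have h3 := hsmall ⟨t, ht.1⟩ (by
      rw [← NNReal.coe_lt_coe]
      have hC0 : (0 : ℝ) ≤ C := C.2
      have : t * C ≤ 1 / ((C : ℝ) + 1) / 2 * C := mul_le_mul_of_nonneg_right ht.2 C.2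
      refine lt_of_le_of_lt this ?_
      rw [NNReal.coe_one]
      rw [div_div, div_mul_eq_mul_div, div_lt_one (by positivity)]
      linarith)
    exact h3.trans Polynomial.eval_C.symm
  -- At `t = 1` the integrand is the Jacobian of `r`. Differentiating `‖r‖ ^ 2 = 1` shows that the
  -- image of the derivative is orthogonal to `r x`, so the derivative is not surjective.
  have h1 : p.eval 1 = 0 := by
    rw [← hp]
    refine integral_eq_zero_of_ae ?_
    refine (ae_restrict_mem measurableSet_ball).mono fun x hx => ?_
    have hxB := ball_subset_closedBall hx
    simp only [one_smul, Pi.zero_apply]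
    set A := ContinuousLinearMap.id ℝ E + fderiv ℝ g x with hA
    by_contra hdet
    have hsurj : Function.Surjective A := by
      have := (LinearMap.isUnit_iff_range_eq_top (A : E →ₗ[ℝ] E)).1
        ((LinearMap.isUnit_iff_isUnit_det _).2 (isUnit_iff_ne_zero.2 hdet))
      exact LinearMap.range_eq_top.1 this
    have hconst : HasFDerivAt (fun y => ‖r y‖ ^ 2) (0 : E →L[ℝ] ℝ) x := by
      refine (hasFDerivAt_const (1 : ℝ) x).congr_of_eventuallyEq ?_
      filter_upwards [isOpen_ball.mem_nhds hx] with y hy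
      rw [hr1 y (ball_subset_closedBall hy), one_pow]
    have heq := hconst.unique (hrderiv x (hBU hxB)).norm_sq
    obtain ⟨y, hy⟩ := hsurj (r x)
    have := congrArg (fun L : E →L[ℝ] ℝ => L y) heq
    simp only [zero_apply] at this
    rw [← hA] at this
    simp [hy, hr1 x hxB] at this
  have hpos : 0 < μ.real (ball (0 : E) 1) :=
    ENNReal.toReal_pos (measure_ball_pos μ _ one_pos).ne' measure_ball_lt_top.ne
  rw [hpc, Polynomial.eval_C] at h1
  exact hpos.ne h1.symm

/-- A smooth self-map of the closed unit ball has a fixed point. -/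
theorem exists_fixedPoint_of_contDiff {E : Type*} [NormedAddCommGroup E] [InnerProductSpace ℝ E]
    [FiniteDimensional ℝ E] {p : E → E} (hp : ContDiff ℝ 1 p)
    (hpB : ∀ x ∈ closedBall (0 : E) 1, ‖p x‖ ≤ 1) : ∃ x ∈ closedBall (0 : E) 1, p x = x := by
  by_contra! hne
  let w : E → E := fun x => x - p x
  -- The ray from `p x` through `x` is followed beyond `x` to the sphere. `l` is the larger root of
  -- the quadratic `‖x + l • w‖ ^ 2 = 1`, and `d` is a quarter of its discriminant.
  let d : E → ℝ := fun x => inner ℝ x (w x) ^ 2 + ‖w x‖ ^ 2 * (1 - ‖x‖ ^ 2)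
  let l : E → ℝ := fun x => (-inner ℝ x (w x) + √(d x)) / ‖w x‖ ^ 2
  have hw : ContDiff ℝ 1 w := contDiff_id.sub hp
  have hd : ContDiff ℝ 1 d := by
    have h1 : ContDiff ℝ 1 fun x : E => ‖x‖ ^ 2 := contDiff_norm_sq ℝ
    have h2 : ContDiff ℝ 1 fun x : E => ‖w x‖ ^ 2 := hw.norm_sq ℝ
    have h3 : ContDiff ℝ 1 fun x : E => inner ℝ x (w x) := contDiff_id.inner ℝ hw
    fun_prop
  have hU : IsOpen {x : E | 0 < d x ∧ w x ≠ 0} :=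
    (isOpen_lt continuous_const hd.continuous).inter (isOpen_ne_fun hw.continuous continuous_const)
  have hw0 : ∀ x ∈ closedBall (0 : E) 1, w x ≠ 0 := fun x hx h =>
    hne x hx (sub_eq_zero.1 h).symm
  -- On the sphere, `2 * ⟪x, w⟫ = ‖w‖ ^ 2 + 1 - ‖p x‖ ^ 2`.
  have hinner : ∀ x ∈ sphere (0 : E) 1, 0 < inner ℝ x (w x) := by
    intro x hx
    have hx1 : ‖x‖ = 1 := by simpa using hx
    have hpx := hpB x (sphere_subset_closedBall hx)
    have h1 : 0 < ‖w x‖ ^ 2 := by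
      have := norm_pos_iff.2 (hw0 x (sphere_subset_closedBall hx)); positivity
    have h2 : ‖w x‖ ^ 2 = ‖x‖ ^ 2 - 2 * inner ℝ x (p x) + ‖p x‖ ^ 2 := norm_sub_sq_real x (p x)
    have h3 : inner ℝ x (w x) = ‖x‖ ^ 2 - inner ℝ x (p x) := by
      simp only [w]; rw [inner_sub_right, real_inner_self_eq_norm_sq]
    rw [h3]
    rw [hx1] at h2 ⊢
    nlinarith [norm_nonneg (p x)]
  have hcase : ∀ x ∈ closedBall (0 : E) 1, ‖x‖ < 1 ∨ x ∈ sphere (0 : E) 1 := by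
    intro x hx
    have : ‖x‖ ≤ 1 := by simpa using hx
    rcases this.lt_or_eq with h | h
    · exact Or.inl h
    · exact Or.inr (by simpa using h)
  have hdpos : ∀ x ∈ closedBall (0 : E) 1, 0 < d x := by
    intro x hx
    have hwp := norm_pos_iff.2 (hw0 x hx)
    rcases hcase x hx with h | h
    · have : 0 < ‖w x‖ ^ 2 * (1 - ‖x‖ ^ 2) := by
        have : 0 < 1 - ‖x‖ ^ 2 := by nlinarith [norm_nonneg x]
        positivity
      simp only [d]; positivity
    · have hx1 : ‖x‖ = 1 := by simpa using h
      have := hinner x h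
      simp only [d, hx1]; norm_num; positivity
  have hl : ContDiffOn ℝ 1 l {x : E | 0 < d x ∧ w x ≠ 0} := by
    refine ContDiffOn.div ?_ (hw.norm_sq ℝ).contDiffOn fun x hx => ?_
    · refine (contDiff_id.inner ℝ hw).neg.contDiffOn.add ?_
      exact hd.contDiffOn.sqrt fun x hx => hx.1.ne'
    · have := norm_pos_iff.2 hx.2; positivity
  refine no_smooth_retraction hU (fun x hx => ⟨hdpos x hx, hw0 x hx⟩)
    (r := fun x => x + l x • w x) (contDiffOn_id.add (hl.smul hw.contDiffOn)) ?_ ?_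
  · intro x hx
    have hwp : 0 < ‖w x‖ ^ 2 := by
      have := norm_pos_iff.2 (hw0 x hx); positivity
    have hsq : √(d x) ^ 2 = d x := Real.sq_sqrt (hdpos x hx).le
    have hlw : l x * ‖w x‖ ^ 2 = -inner ℝ x (w x) + √(d x) := by
      exact div_mul_cancel₀ _ hwp.ne'
    have hnorm : ‖x + l x • w x‖ ^ 2 = 1 := by
      rw [norm_add_sq_real, inner_smul_right, norm_smul, Real.norm_eq_abs, mul_pow, sq_abs]
      have h2 : (l x * ‖w x‖ ^ 2 + inner ℝ x (w x)) ^ 2 = d x := by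
        rw [hlw, neg_add_cancel_comm, hsq]
      have h3 : ‖w x‖ ^ 2 * (‖x‖ ^ 2 + 2 * (l x * inner ℝ x (w x)) + l x ^ 2 * ‖w x‖ ^ 2)
          = ‖w x‖ ^ 2 * 1 := by
        simp only [d] at h2
        linear_combination h2
      exact mul_left_cancel₀ hwp.ne' h3
    have h0 := norm_nonneg (x + l x • w x)
    nlinarith
  · intro x hx
    have hx1 : ‖x‖ = 1 := by simpa using hx
    have : l x = 0 := by
      simp only [l, d, hx1]
      norm_num
      left
      rw [Real.sqrt_sq (hinner x hx).le]; ring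
    simp [this]

/-- **Brouwer's fixed point theorem**, for maps of the whole space into the unit ball. -/
theorem exists_fixedPoint_of_norm_le_one {E : Type*} [NormedAddCommGroup E] [InnerProductSpace ℝ E]
    [FiniteDimensional ℝ E] {φ : E → E} (hφ : Continuous φ) (hB : ∀ x, ‖φ x‖ ≤ 1) :
    ∃ x, φ x = x := by
  by_contra! hne
  have hK := isCompact_closedBall (0 : E) 1
  obtain ⟨x₀, hx₀, hmin⟩ := hK.exists_isMinOn (f := fun x => ‖φ x - x‖)
    ⟨0, by simp⟩ (by fun_prop)
  set m := ‖φ x₀ - x₀‖ with hm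
  have hm0 : 0 < m := norm_pos_iff.2 (sub_ne_zero.2 (hne x₀))
  -- A smooth `ε`-approximation, shrunk by `1 + ε` to map the ball into itself, has a fixed point
  -- that `φ` moves by at most `2 * ε`, which is less than the minimal displacement `m`.
  set ε := m / 4 with hε
  have hε0 : 0 < ε := by positivity
  obtain ⟨δ, hδ, hφδ⟩ := Metric.uniformContinuousOn_iff.mp
    ((isCompact_closedBall (0 : E) 2).uniformContinuousOn_of_continuous hφ.continuousOn) ε hε0
  obtain ⟨g, hg, hgφ⟩ := hφ.exists_contDiff_dist_le_of_forall_mem_ball_dist_le (lt_min one_pos hδ)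
  have hclose : ∀ x ∈ closedBall (0 : E) 1, ‖g x - φ x‖ ≤ ε := by
    intro x hx
    rw [← dist_eq_norm]
    have hx1 : ‖x‖ ≤ 1 := by simpa using hx
    refine hgφ x ε fun y hy => (hφδ y ?_ x ?_ ?_).le
    · have h1 : dist y x < 1 := (mem_ball.1 hy).trans_le (min_le_left _ _)
      have h2 : ‖y‖ ≤ ‖y - x‖ + ‖x‖ := by simpa using norm_add_le (y - x) x
      rw [dist_eq_norm] at h1
      simp; linarith
    · simp; linarith
    · exact (mem_ball.1 hy).trans_le (min_le_right _ _)
  have hgn : ∀ x ∈ closedBall (0 : E) 1, ‖g x‖ ≤ 1 + ε := fun x hx => by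
    have := norm_add_le (g x - φ x) (φ x)
    rw [sub_add_cancel] at this
    linarith [hclose x hx, hB x]
  obtain ⟨x, hx, hfix⟩ := exists_fixedPoint_of_contDiff (p := fun x => (1 + ε)⁻¹ • g x)
    ((hg.of_le (by exact_mod_cast le_top)).const_smul _) (fun x hx => by
      rw [norm_smul, Real.norm_of_nonneg (by positivity), inv_mul_le_one₀ (by positivity)]
      exact hgn x hx)
  have hgx : g x = (1 + ε) • x := by
    rw [← hfix, smul_smul, mul_inv_cancel₀ (by positivity), one_smul, hfix]
  have h1 : m ≤ ‖φ x - x‖ := hmin hx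
  have h2 : ‖φ x - x‖ ≤ ‖g x - φ x‖ + ‖g x - x‖ := by
    have := norm_add_le (φ x - g x) (g x - x)
    rwa [sub_add_sub_cancel, norm_sub_rev (φ x) (g x)] at this
  have h3 : ‖g x - x‖ ≤ ε := by
    rw [hgx, add_smul, one_smul, add_sub_cancel_left, norm_smul, Real.norm_of_nonneg hε0.le]
    have hx1 : ‖x‖ ≤ 1 := by simpa using hx
    exact mul_le_of_le_one_right hε0.le hx1
  have := hclose x hx
  linarith

/-- The metric projection onto a closed convex set. -/
theorem exists_continuous_projection {E : Type*} [NormedAddCommGroup E] [InnerProductSpace ℝ E]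
    {K : Set E} (hne : K.Nonempty) (hK : IsComplete K) (hconv : Convex ℝ K) :
    ∃ P : E → E, Continuous P ∧ (∀ x, P x ∈ K) ∧ ∀ x, ∀ y ∈ K, inner ℝ (x - P x) (y - P x) ≤ 0 := by
  choose P hPK hP using exists_norm_eq_iInf_of_complete_convex hne hK hconv
  have hchar : ∀ x, ∀ y ∈ K, inner ℝ (x - P x) (y - P x) ≤ 0 := fun x =>
    (norm_eq_iInf_iff_real_inner_le_zero hconv (hPK x)).1 (hP x)
  refine ⟨P, LipschitzWith.continuous (K := 1) (LipschitzWith.of_dist_le_mul fun x y => ?_), hPK,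
    hchar⟩
  rw [dist_eq_norm, dist_eq_norm, NNReal.coe_one, one_mul]
  have h1 := hchar x _ (hPK y)
  have h2 := hchar y _ (hPK x)
  have h3 : ‖P x - P y‖ ^ 2 ≤ inner ℝ (x - y) (P x - P y) := by
    rw [← real_inner_self_eq_norm_sq]
    have e1 : inner ℝ (x - P x) (P y - P x) = - inner ℝ (x - P x) (P x - P y) := by
      rw [← inner_neg_right, neg_sub]
    have e2 : inner ℝ (x - y) (P x - P y) = inner ℝ (x - P x) (P x - P y)
        + inner ℝ (P x - P y) (P x - P y) - inner ℝ (y - P y) (P x - P y) := by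
      rw [← inner_add_left, ← inner_sub_left]; congr 1; abel
    linarith
  have h4 := real_inner_le_norm (x - y) (P x - P y)
  by_contra! hlt
  have : 0 < ‖P x - P y‖ := (norm_nonneg _).trans_lt hlt
  nlinarith

/-- **Hartman-Stampacchia**: a variational inequality over a compact convex set has a solution. -/
theorem exists_variationalInequality {ι : Type*} [Fintype ι] {K : Set (ι → ℝ)} (hne : K.Nonempty)
    (hK : IsCompact K) (hconv : Convex ℝ K) {Φ : (ι → ℝ) → ι → ℝ} (hΦ : ContinuousOn Φ K) :
    ∃ z ∈ K, ∀ y ∈ K, 0 ≤ ∑ i, Φ z i * (y i - z i) := by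
  let e := EuclideanSpace.equiv ι ℝ
  let K' : Set (EuclideanSpace ℝ ι) := e ⁻¹' K
  have hK' : IsCompact K' := e.toHomeomorph.isCompact_preimage.2 hK
  have hne' : K'.Nonempty := hne.preimage e.surjective
  have hconv' : Convex ℝ K' := hconv.linear_preimage (e : EuclideanSpace ℝ ι →ₗ[ℝ] (ι → ℝ))
  obtain ⟨P, hPc, hPK, hP⟩ := exists_continuous_projection hne' hK'.isComplete hconv'
  obtain ⟨R, hR⟩ := hK'.isBounded.exists_norm_le
  set M := max R 1 with hM
  have hM0 : 0 < M := lt_max_of_lt_right one_pos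
  -- Solutions are the fixed points of `z ↦ P (z - Φ z)`. The inner projection makes the map defined
  -- and continuous on the whole space; the factor `M` below rescales its range into the unit ball.
  let Ψ : EuclideanSpace ℝ ι → EuclideanSpace ℝ ι := fun x => P (P x - e.symm (Φ (e (P x))))
  have hΨ : Continuous Ψ := by
    refine hPc.comp (hPc.sub (e.symm.continuous.comp ?_))
    exact hΦ.comp_continuous (e.continuous.comp hPc) hPK
  obtain ⟨u, hu⟩ := exists_fixedPoint_of_norm_le_one (φ := fun x => M⁻¹ • Ψ (M • x))
    (by fun_prop) (fun x => by
      rw [norm_smul, Real.norm_of_nonneg (by positivity), inv_mul_le_one₀ hM0]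
      exact (hR _ (hPK _)).trans (le_max_left _ _))
  set z := M • u with hz
  have hzfix : Ψ z = z := by
    rw [← smul_inv_smul₀ hM0.ne' (Ψ z), hu]
  have hzK : z ∈ K' := by rw [← hzfix]; exact hPK _
  have hPz : P z = z := by
    have h := hP z z hzK
    rw [real_inner_self_eq_norm_sq] at h
    have : ‖z - P z‖ = 0 := by nlinarith [norm_nonneg (z - P z)]
    exact (sub_eq_zero.1 (norm_eq_zero.1 this)).symm
  refine ⟨e z, hzK, fun y hy => ?_⟩
  have h := hP (z - e.symm (Φ (e z))) (e.symm y) (by simpa [K'] using hy)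
  have hz2 : P (z - e.symm (Φ (e z))) = z := by
    have := hzfix
    simp only [Ψ, hPz] at this
    exact this
  rw [hz2, sub_sub_cancel_left, inner_neg_left] at h
  have h5 : inner ℝ (e.symm (Φ (e z))) (e.symm y - z) = ∑ i, Φ (e z) i * (y i - e z i) := by
    rw [PiLp.inner_apply]
    refine Finset.sum_congr rfl fun i _ => ?_
    simp [e, mul_comm]
  linarith

end

/-! ### Technologies, effort costs and the marginal cost of output -/

section
open Set Filter Topology
namespace Bargaining

theorem convexOn_tangent_le {g : ℝ → ℝ} (hg : ConvexOn ℝ (Ici 0) g) {x y : ℝ} (hx : 0 < x)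
    (hy : 0 ≤ y) (hd : DifferentiableAt ℝ g x) : deriv g x * (y - x) ≤ g y - g x := by
  rcases lt_trichotomy x y with h | h | h
  · have := hg.le_slope_of_hasDerivAt (mem_Ici.2 hx.le) (mem_Ici.2 hy) h hd.hasDerivAt
    rwa [slope_def_field, le_div_iff₀ (sub_pos.2 h)] at this
  · simp [h]
  · have := hg.slope_le_of_hasDerivAt (mem_Ici.2 hy) (mem_Ici.2 hx.le) h hd.hasDerivAt
    rw [slope_def_field, div_le_iff₀ (sub_pos.2 h)] at this
    linarith

section Technology
variable {f : ℝ → ℝ}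

theorem IsTechnology.strictMonoOn (hf : IsTechnology f) : StrictMonoOn f (Ici 0) :=
  strictMonoOn_of_deriv_pos (convex_Ici 0) hf.1 fun x hx => (hf.2.2 x (by simpa using hx)).2.2.1

theorem IsTechnology.nonneg (hf : IsTechnology f) {x : ℝ} (hx : 0 ≤ x) : 0 ≤ f x := by
  have := hf.strictMonoOn.monotoneOn (mem_Ici.2 le_rfl) (mem_Ici.2 hx) hx
  rwa [hf.2.1] at this

theorem IsTechnology.pos (hf : IsTechnology f) {x : ℝ} (hx : 0 < x) : 0 < f x := by
  have := hf.strictMonoOn (mem_Ici.2 le_rfl) (mem_Ici.2 hx.le) hx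
  rwa [hf.2.1] at this

theorem IsTechnology.concaveOn (hf : IsTechnology f) : ConcaveOn ℝ (Ici 0) f :=
  concaveOn_of_deriv2_nonpos (convex_Ici 0) hf.1
    (fun x hx => (hf.2.2 x (by simpa using hx)).1.differentiableWithinAt)
    (fun x hx => (hf.2.2 x (by simpa using hx)).2.1.differentiableWithinAt)
    fun x hx => (hf.2.2 x (by simpa using hx)).2.2.2

theorem IsTechnology.le_tangent (hf : IsTechnology f) {x y : ℝ} (hx : 0 < x) (hy : 0 ≤ y) :
    f y - f x ≤ deriv f x * (y - x) := by
  have := convexOn_tangent_le hf.concaveOn.neg hx hy (hf.2.2 x hx).1.neg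
  rw [deriv.neg'] at this
  simp only [Pi.neg_apply] at this
  linarith

theorem IsTechnology.antitoneOn_deriv (hf : IsTechnology f) : AntitoneOn (deriv f) (Ioi 0) :=
  antitoneOn_of_deriv_nonpos (convex_Ioi 0)
    (fun x hx => (hf.2.2 x hx).2.1.continuousAt.continuousWithinAt)
    (fun x hx => (hf.2.2 x (by simpa using hx)).2.1.differentiableWithinAt)
    fun x hx => (hf.2.2 x (by simpa using hx)).2.2.2

end Technology

section Cost
variable {c : ℝ → ℝ}

theorem IsEffortCost.strictMonoOn (hc : IsEffortCost c) : StrictMonoOn c (Ici 0) :=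
  strictMonoOn_of_deriv_pos (convex_Ici 0) hc.1 fun x hx => (hc.2.2 x (by simpa using hx)).2.2.1

theorem IsEffortCost.nonneg (hc : IsEffortCost c) {x : ℝ} (hx : 0 ≤ x) : 0 ≤ c x := by
  have := hc.strictMonoOn.monotoneOn (mem_Ici.2 le_rfl) (mem_Ici.2 hx) hx
  rwa [hc.2.1] at this

theorem IsEffortCost.pos (hc : IsEffortCost c) {x : ℝ} (hx : 0 < x) : 0 < c x := by
  have := hc.strictMonoOn (mem_Ici.2 le_rfl) (mem_Ici.2 hx.le) hx
  rwa [hc.2.1] at this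

theorem IsEffortCost.tangent_le (hc : IsEffortCost c) {x y : ℝ} (hx : 0 < x) (hy : 0 ≤ y) :
    deriv c x * (y - x) ≤ c y - c x := by
  refine convexOn_tangent_le ?_ hx hy (hc.2.2 x hx).1
  exact convexOn_of_deriv2_nonneg (convex_Ici 0) hc.1
    (fun x hx => (hc.2.2 x (by simpa using hx)).1.differentiableWithinAt)
    (fun x hx => (hc.2.2 x (by simpa using hx)).2.1.differentiableWithinAt)
    fun x hx => (hc.2.2 x (by simpa using hx)).2.2.2

theorem IsEffortCost.monotoneOn_deriv (hc : IsEffortCost c) : MonotoneOn (deriv c) (Ioi 0) :=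
  monotoneOn_of_deriv_nonneg (convex_Ioi 0)
    (fun x hx => (hc.2.2 x hx).2.1.continuousAt.continuousWithinAt)
    (fun x hx => (hc.2.2 x (by simpa using hx)).2.1.differentiableWithinAt)
    fun x hx => (hc.2.2 x (by simpa using hx)).2.2.2

theorem IsEffortCost.exists_one_lt (hc : IsEffortCost c) : ∃ X, 0 < X ∧ 1 < c X := by
  have h1 := (hc.2.2 1 one_pos).2.2.1
  have hX : 0 < 1 + (deriv c 1)⁻¹ := by positivity
  refine ⟨1 + (deriv c 1)⁻¹, hX, ?_⟩
  have := hc.tangent_le one_pos hX.le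
  rw [add_sub_cancel_left, mul_inv_cancel₀ h1.ne'] at this
  linarith [hc.pos one_pos]

end Cost

/-- `r` is the marginal cost of output, as a function of effort, for the technology `f` and the
effort cost `c`. -/
structure IsMarginalCost (f c r : ℝ → ℝ) : Prop where
  continuousOn : ContinuousOn r (Ici 0)
  monotoneOn : MonotoneOn r (Ici 0)
  pos : ∀ x, 0 < x → 0 < r x
  nonneg : ∀ x, 0 ≤ x → 0 ≤ r x
  mul_sub_le : ∀ x y, 0 ≤ x → 0 ≤ y → r x * (f y - f x) ≤ c y - c x

-- `c` is a convex function of the output `f`, and `r = c' / f'` is its derivative, indexed by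
-- effort. Since derivatives at zero effort need not exist, `r 0` is the infimum of `c' / f'`. By
-- monotonicity this is the right limit at zero, so the subgradient inequality at `0` follows by
-- passing to the limit.
open Classical in
theorem exists_isMarginalCost {f c : ℝ → ℝ} (hf : IsTechnology f) (hc : IsEffortCost c) :
    ∃ r, IsMarginalCost f c r := by
  let ρ : ℝ → ℝ := fun x => deriv c x / deriv f x
  have hρpos : ∀ x, 0 < x → 0 < ρ x := fun x hx =>
    div_pos (hc.2.2 x hx).2.2.1 (hf.2.2 x hx).2.2.1
  have hρmono : MonotoneOn ρ (Ioi 0) := by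
    intro x hx y hy hxy
    exact div_le_div₀ (hc.2.2 y hy).2.2.1.le (hc.monotoneOn_deriv hx hy hxy) (hf.2.2 y hy).2.2.1
      (hf.antitoneOn_deriv hx hy hxy)
  have hρbdd : BddBelow (ρ '' Ioi 0) := ⟨0, by rintro _ ⟨x, hx, rfl⟩; exact (hρpos x hx).le⟩
  have hinf0 : 0 ≤ sInf (ρ '' Ioi 0) :=
    le_csInf ⟨_, mem_image_of_mem ρ (mem_Ioi.2 one_pos)⟩
      (by rintro _ ⟨x, hx, rfl⟩; exact (hρpos x hx).le)
  let r : ℝ → ℝ := fun x => if 0 < x then ρ x else sInf (ρ '' Ioi 0)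
  have hr : ∀ x, 0 < x → r x = ρ x := fun x hx => if_pos hx
  have hr0 : r 0 = sInf (ρ '' Ioi 0) := if_neg (lt_irrefl 0)
  have hcont : ContinuousOn r (Ici 0) := by
    intro x hx
    rcases (mem_Ici.1 hx).eq_or_lt with rfl | h
    · rw [← continuousWithinAt_Ioi_iff_Ici, ContinuousWithinAt, hr0]
      refine (hρmono.tendsto_nhdsGT hρbdd).congr' ?_
      filter_upwards [self_mem_nhdsWithin] with y hy using (hr y hy).symm
    · refine ContinuousAt.continuousWithinAt ?_
      have : ContinuousAt ρ x := (hc.2.2 x h).2.1.continuousAt.div (hf.2.2 x h).2.1.continuousAt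
        (hf.2.2 x h).2.2.1.ne'
      refine this.congr ?_
      filter_upwards [lt_mem_nhds h] with y hy using (hr y hy).symm
  have hsub : ∀ x y, 0 < x → 0 ≤ y → r x * (f y - f x) ≤ c y - c x := by
    intro x y hx hy
    rw [hr x hx]
    have hf' := (hf.2.2 x hx).2.2.1
    calc ρ x * (f y - f x) ≤ ρ x * (deriv f x * (y - x)) :=
          mul_le_mul_of_nonneg_left (hf.le_tangent hx hy) (hρpos x hx).le
      _ = deriv c x * (y - x) := by simp only [ρ]; field_simp
      _ ≤ _ := hc.tangent_le hx hy
  refine ⟨r, hcont, ?_, fun x hx => by rw [hr x hx]; exact hρpos x hx, ?_, ?_⟩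
  · intro x hx y hy hxy
    rcases (mem_Ici.1 hx).eq_or_lt with rfl | h
    · rcases (mem_Ici.1 hy).eq_or_lt with rfl | h'
      · exact le_rfl
      · rw [hr0, hr y h']; exact csInf_le hρbdd (mem_image_of_mem ρ h')
    · rw [hr x h, hr y (h.trans_le hxy)]; exact hρmono h (h.trans_le hxy) hxy
  · intro x hx
    rcases hx.eq_or_lt with rfl | h
    · rw [hr0]; exact hinf0
    · rw [hr x h]; exact (hρpos x h).le
  · intro x y hx hy
    rcases hx.eq_or_lt with rfl | h
    · have hc0 : ∀ {g : ℝ → ℝ}, ContinuousOn g (Ici 0) → Tendsto g (𝓝[>] 0) (𝓝 (g 0)) :=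
        fun hg => (hg 0 (mem_Ici.2 le_rfl)).tendsto.mono_left
          (nhdsWithin_mono _ Ioi_subset_Ici_self)
      refine le_of_tendsto_of_tendsto ((hc0 hcont).mul ((hc0 hf.1).const_sub (f y)))
        ((hc0 hc.1).const_sub (c y)) ?_
      filter_upwards [self_mem_nhdsWithin] with x hx using hsub x y hx hy
    · exact hsub x y h hy

end Bargaining

end

/-! ### Shares, stakes and sufficiency of the first-order conditions -/

section
open Set Filter Topology
namespace Bargaining

namespace Game
variable {n : ℕ} (G : Game n)

/-- The price of the votes of the members of `C`. -/
def price (v : Fin n → ℝ) (C : Finset (Fin n)) : ℝ := ∑ j ∈ C, G.δ j * v j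

/-- The expected share of agent `i` if agent `j` is the proposer and draws the coalition `C` with
probability `q j C`. -/
def reward (v : Fin n → ℝ) (q : Fin n → Finset (Fin n) → ℝ) (j i : Fin n) : ℝ :=
  if j = i then 1 - ∑ C, q i C * G.price v C
  else (∑ C : Finset (Fin n) with i ∈ C, q j C) * (G.δ i * v i)

/-- The impacts, as functions of real efforts. -/
def output (x : Fin n → ℝ) (i : Fin n) : ℝ := G.α i * G.f i (x i) + G.β i

/-- The numerator of the marginal return to output: what agent `i` would gain if he took over the
output of the others. -/
def stake (x v : Fin n → ℝ) (q : Fin n → Finset (Fin n) → ℝ) (i : Fin n) : ℝ :=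
  ∑ j, G.output x j * (G.reward v q i i - G.reward v q j i)

/-- Continuation values and mixtures over winning coalitions. -/
structure IsBargain (v : Fin n → ℝ) (q : Fin n → Finset (Fin n) → ℝ) : Prop where
  v_nonneg : ∀ i, 0 ≤ v i
  v_sum : ∑ i, v i ≤ 1
  q_nonneg : ∀ i C, 0 ≤ q i C
  q_sum : ∀ i, ∑ C, q i C = 1
  q_eq_zero : ∀ i C, ¬ (i ∉ C ∧ C.card + 1 = G.k) → q i C = 0

end Game

/-- A game with the bounds and the marginal costs of output used in the existence proof. -/
structure RegularGame (n : ℕ) extends Game n where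
  r : Fin n → ℝ → ℝ
  X : Fin n → ℝ
  η : ℝ
  α_nonneg : ∀ i, 0 ≤ α i
  β_nonneg : ∀ i, 0 ≤ β i
  δ_pos : ∀ i, 0 < δ i
  δ_le : ∀ i, δ i ≤ 1 - η
  η_pos : 0 < η
  f_continuous : ∀ i, Continuous (f i)
  c_continuous : ∀ i, Continuous (c i)
  r_continuous : ∀ i, Continuous (r i)
  f_zero : ∀ i, f i 0 = 0
  f_mono : ∀ i, StrictMonoOn (f i) (Ici 0)
  f_concave : ∀ i, ConcaveOn ℝ (Ici 0) (f i)
  c_zero : ∀ i, c i 0 = 0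
  c_nonneg : ∀ i x, 0 ≤ x → 0 ≤ c i x
  c_large : ∀ i x, X i < x → 1 < c i x
  X_pos : ∀ i, 0 < X i
  r_mono : ∀ i, MonotoneOn (r i) (Ici 0)
  r_pos : ∀ i x, 0 < x → 0 < r i x
  r_mul_le : ∀ i x y, 0 ≤ x → 0 ≤ y → r i x * (f i y - f i x) ≤ c i y - c i x
  k_pos : 1 ≤ k
  k_le : k ≤ n

namespace Game.IsBargain
variable {n : ℕ} {G : RegularGame n} {v : Fin n → ℝ} {q : Fin n → Finset (Fin n) → ℝ}

theorem price_nonneg (h : G.IsBargain v q) (C : Finset (Fin n)) : 0 ≤ G.price v C :=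
  Finset.sum_nonneg fun j _ => mul_nonneg (G.δ_pos j).le (h.v_nonneg j)

/-- Even buying every vote and his own continuation value would cost the proposer at most `∑ j, δ j
* v j ≤ 1 - η`. This surplus `η` is what keeps competition alive. -/
theorem price_add_le (h : G.IsBargain v q) {i : Fin n} {C : Finset (Fin n)} (hi : i ∉ C) :
    G.price v C + G.δ i * v i ≤ 1 - G.η := by
  have h0 : ∀ j, 0 ≤ G.δ j * v j := fun j => mul_nonneg (G.δ_pos j).le (h.v_nonneg j)
  have hη : 0 ≤ 1 - G.η := (G.δ_pos i).le.trans (G.δ_le i)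
  calc G.price v C + G.δ i * v i = ∑ j ∈ insert i C, G.δ j * v j := by
        rw [Finset.sum_insert hi, Game.price, add_comm]
    _ ≤ ∑ j, G.δ j * v j :=
        Finset.sum_le_sum_of_subset_of_nonneg (Finset.subset_univ _) fun j _ _ => h0 j
    _ ≤ ∑ j, (1 - G.η) * v j :=
        Finset.sum_le_sum fun j _ => mul_le_mul_of_nonneg_right (G.δ_le j) (h.v_nonneg j)
    _ = (1 - G.η) * ∑ j, v j := by rw [Finset.mul_sum]
    _ ≤ 1 - G.η := mul_le_of_le_one_right hη h.v_sum

theorem mean_price_add_le (h : G.IsBargain v q) (i : Fin n) :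
    ∑ C, q i C * G.price v C + G.δ i * v i ≤ 1 - G.η := by
  have : ∑ C, q i C * G.price v C ≤ ∑ C, q i C * (1 - G.η - G.δ i * v i) := by
    refine Finset.sum_le_sum fun C _ => ?_
    by_cases hC : i ∉ C ∧ C.card + 1 = G.k
    · exact mul_le_mul_of_nonneg_left (by linarith [h.price_add_le hC.1]) (h.q_nonneg i C)
    · simp [h.q_eq_zero i C hC]
  rw [← Finset.sum_mul, h.q_sum, one_mul] at this
  linarith

theorem inclusion_mem (h : G.IsBargain v q) (j i : Fin n) :
    0 ≤ ∑ C : Finset (Fin n) with i ∈ C, q j C ∧ ∑ C : Finset (Fin n) with i ∈ C, q j C ≤ 1 := by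
  refine ⟨Finset.sum_nonneg fun C _ => h.q_nonneg j C, ?_⟩
  rw [← h.q_sum j]
  exact Finset.sum_le_sum_of_subset_of_nonneg (Finset.filter_subset _ _)
    fun C _ _ => h.q_nonneg j C

theorem reward_self_add_le (h : G.IsBargain v q) (i : Fin n) :
    G.η + G.δ i * v i ≤ G.reward v q i i := by
  rw [Game.reward, if_pos rfl]
  linarith [h.mean_price_add_le i]

theorem reward_le_of_ne (h : G.IsBargain v q) {i j : Fin n} (hij : j ≠ i) :
    G.reward v q j i ≤ G.δ i * v i := by
  rw [Game.reward, if_neg hij]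
  exact mul_le_of_le_one_left (mul_nonneg (G.δ_pos i).le (h.v_nonneg i)) (h.inclusion_mem j i).2

theorem reward_nonneg (h : G.IsBargain v q) (j i : Fin n) : 0 ≤ G.reward v q j i := by
  have h0 := mul_nonneg (G.δ_pos i).le (h.v_nonneg i)
  by_cases hij : j = i
  · subst hij; linarith [h.reward_self_add_le j, G.η_pos]
  · rw [Game.reward, if_neg hij]; exact mul_nonneg (h.inclusion_mem j i).1 h0

theorem reward_self_le_one (h : G.IsBargain v q) (i : Fin n) : G.reward v q i i ≤ 1 := by
  rw [Game.reward, if_pos rfl]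
  have := Finset.sum_nonneg (s := Finset.univ) fun C _ =>
    mul_nonneg (h.q_nonneg i C) (h.price_nonneg C)
  linarith

theorem reward_gap (h : G.IsBargain v q) {i j : Fin n} (hij : j ≠ i) :
    G.η ≤ G.reward v q i i - G.reward v q j i := by
  linarith [h.reward_self_add_le i, h.reward_le_of_ne hij]

/-- Whoever proposes, the whole dollar is distributed. Hence net payoffs sum to at most one and are
admissible as values. -/
theorem sum_reward (h : G.IsBargain v q) (j : Fin n) : ∑ i, G.reward v q j i = 1 := by
  have key : ∀ i, G.reward v q j i = (if j = i then 1 - ∑ C, q j C * G.price v C else 0)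
      + ∑ C, q j C * (if i ∈ C then G.δ i * v i else 0) := by
    intro i
    have e : (∑ C : Finset (Fin n) with i ∈ C, q j C) * (G.δ i * v i) =
        ∑ C, q j C * (if i ∈ C then G.δ i * v i else 0) := by
      rw [Finset.sum_mul, Finset.sum_filter]
      exact Finset.sum_congr rfl fun C _ => by split_ifs <;> simp
    rw [Game.reward]
    split_ifs with hij
    · subst hij
      have : ∑ C, q j C * (if j ∈ C then G.δ j * v j else 0) = 0 :=
        Finset.sum_eq_zero fun C _ => by
          by_cases hC : j ∈ C
          · simp [h.q_eq_zero j C fun hh => hh.1 hC]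
          · simp [hC]
      rw [this, add_zero]
    · rw [zero_add, e]
  simp_rw [key]
  rw [Finset.sum_add_distrib, Finset.sum_ite_eq Finset.univ j, if_pos (Finset.mem_univ _),
    Finset.sum_comm]
  have : ∀ C, ∑ i, q j C * (if i ∈ C then G.δ i * v i else 0) = q j C * G.price v C := by
    intro C
    rw [← Finset.mul_sum, Finset.sum_ite_mem, Finset.univ_inter, Game.price]
  simp_rw [this]
  ring

end Game.IsBargain

namespace RegularGame
variable {n : ℕ} (G : RegularGame n)

theorem f_nonneg (i : Fin n) {x : ℝ} (hx : 0 ≤ x) : 0 ≤ G.f i x := by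
  have := (G.f_mono i).monotoneOn (mem_Ici.2 le_rfl) (mem_Ici.2 hx) hx
  rwa [G.f_zero] at this

theorem output_nonneg {x : Fin n → ℝ} (hx : ∀ i, 0 ≤ x i) (i : Fin n) : 0 ≤ G.output x i :=
  add_nonneg (mul_nonneg (G.α_nonneg i) (G.f_nonneg i (hx i))) (G.β_nonneg i)

theorem sum_output_mul_reward {v : Fin n → ℝ} {q : Fin n → Finset (Fin n) → ℝ}
    (x : Fin n → ℝ) (i : Fin n) :
    ∑ j, G.output x j * G.reward v q j i =
      (∑ j, G.output x j) * G.reward v q i i - G.stake x v q i := by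
  rw [Game.stake, Finset.sum_mul, ← Finset.sum_sub_distrib]
  exact Finset.sum_congr rfl fun j _ => by ring

/-- The agent's own term in the stake has coefficient zero, so his effort affects his expected share
only through the denominator, total output. -/
theorem stake_update {v : Fin n → ℝ} {q : Fin n → Finset (Fin n) → ℝ} (x : Fin n → ℝ)
    (i : Fin n) (y : ℝ) : G.stake (Function.update x i y) v q i = G.stake x v q i := by
  refine Finset.sum_congr rfl fun j _ => ?_
  by_cases hij : j = i
  · subst hij; simp
  · simp [Game.output, Function.update_of_ne hij]

theorem sum_output_update (x : Fin n → ℝ) (i : Fin n) (y : ℝ) :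
    ∑ j, G.output (Function.update x i y) j =
      ∑ j, G.output x j + G.α i * (G.f i y - G.f i (x i)) := by
  rw [← Finset.add_sum_erase _ _ (Finset.mem_univ i),
    ← Finset.add_sum_erase _ (G.output x) (Finset.mem_univ i)]
  have : ∑ j ∈ Finset.univ.erase i, G.output (Function.update x i y) j =
      ∑ j ∈ Finset.univ.erase i, G.output x j :=
    Finset.sum_congr rfl fun j hj => by
      simp [Game.output, Function.update_of_ne (Finset.ne_of_mem_erase hj)]
  rw [this]
  simp [Game.output]
  ring

theorem stake_nonneg {v : Fin n → ℝ} {q : Fin n → Finset (Fin n) → ℝ} (h : G.IsBargain v q)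
    {x : Fin n → ℝ} (hx : ∀ i, 0 ≤ x i) (i : Fin n) : 0 ≤ G.stake x v q i := by
  refine Finset.sum_nonneg fun j _ => mul_nonneg (G.output_nonneg hx j) ?_
  by_cases hij : j = i
  · simp [hij]
  · exact G.η_pos.le.trans (h.reward_gap hij)

theorem le_stake {v : Fin n → ℝ} {q : Fin n → Finset (Fin n) → ℝ} (h : G.IsBargain v q)
    {x : Fin n → ℝ} (hx : ∀ i, 0 ≤ x i) (i : Fin n) :
    G.η * (∑ j, G.output x j - G.output x i) ≤ G.stake x v q i := by
  rw [← Finset.sum_erase_eq_sub (Finset.mem_univ i), Game.stake,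
    ← Finset.add_sum_erase _ _ (Finset.mem_univ i), sub_self, mul_zero, zero_add, Finset.mul_sum]
  refine Finset.sum_le_sum fun j hj => ?_
  rw [mul_comm]
  exact mul_le_mul_of_nonneg_left (h.reward_gap (Finset.ne_of_mem_erase hj)) (G.output_nonneg hx j)

/-- The first-order conditions for the effort of one agent are sufficient for optimality. -/
theorem effort_optimal (i : Fin n) {D R x y : ℝ} (hD : 0 ≤ D) (hR : 0 < R) (hx : 0 ≤ x)
    (hy : 0 ≤ y) (hup : x < y → G.α i * D ≤ (R + G.α i * G.f i x) ^ 2 * G.r i x)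
    (hdown : 0 < x → (R + G.α i * G.f i x) ^ 2 * G.r i x ≤ G.α i * D) :
    -(D / (R + G.α i * G.f i y)) - G.c i y ≤ -(D / (R + G.α i * G.f i x)) - G.c i x := by
  set S := R + G.α i * G.f i x with hS
  set T := R + G.α i * G.f i y with hT
  have hS0 : 0 < S := by
    have := mul_nonneg (G.α_nonneg i) (G.f_nonneg i hx); linarith
  have hT0 : 0 < T := by
    have := mul_nonneg (G.α_nonneg i) (G.f_nonneg i hy); linarith
  have hTS : T - S = G.α i * (G.f i y - G.f i x) := by rw [hS, hT]; ring
  have hsub := G.r_mul_le i x y hx hy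
  -- Tangent bound for the convex function `T ↦ D / T` at `S`; the error is an explicit square.
  have h1 : D / S - D / T ≤ D * (T - S) / S ^ 2 := by
    have : D * (T - S) / S ^ 2 - (D / S - D / T) = D * (T - S) ^ 2 / (S ^ 2 * T) := by
      field_simp
    have h2 : 0 ≤ D * (T - S) ^ 2 / (S ^ 2 * T) := by positivity
    linarith
  have h3 : D * (T - S) / S ^ 2 ≤ G.r i x * (G.f i y - G.f i x) := by
    rw [div_le_iff₀ (by positivity), hTS]
    rcases lt_or_ge x y with h | h
    · have hf : 0 ≤ G.f i y - G.f i x :=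
        sub_nonneg.2 ((G.f_mono i).monotoneOn (mem_Ici.2 hx) (mem_Ici.2 hy) h.le)
      nlinarith [mul_le_mul_of_nonneg_right (hup h) hf]
    · rcases hx.eq_or_lt with h0 | h0
      · have : y = x := le_antisymm h (h0 ▸ hy)
        simp [this]
      · have hf : 0 ≤ G.f i x - G.f i y :=
          sub_nonneg.2 ((G.f_mono i).monotoneOn (mem_Ici.2 hy) (mem_Ici.2 hx) h)
        nlinarith [mul_le_mul_of_nonneg_right (hdown h0) hf]
  linarith

end RegularGame
end Bargaining

end

/-! ### The variational inequality for efforts, values and coalition mixtures -/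

section
open Set Filter Topology
namespace Bargaining

/-- The coordinates of the fixed point problem: efforts, values and mixtures over coalitions. -/
abbrev Coord (n : ℕ) : Type := Fin n ⊕ Fin n ⊕ (Fin n × Finset (Fin n))

namespace Coord
variable {n : ℕ}

/-- A point of the domain with given efforts, values and mixtures. -/
def pack (x v : Fin n → ℝ) (q : Fin n → Finset (Fin n) → ℝ) : Coord n → ℝ :=
  Sum.elim x (Sum.elim v fun p => q p.1 p.2)

/-- The efforts at a point of the domain. -/
def effort (z : Coord n → ℝ) (i : Fin n) : ℝ := z (.inl i)

/-- The values at a point of the domain. -/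
def value (z : Coord n → ℝ) (i : Fin n) : ℝ := z (.inr (.inl i))

/-- The mixtures over coalitions at a point of the domain. -/
def mix (z : Coord n → ℝ) (i : Fin n) (C : Finset (Fin n)) : ℝ := z (.inr (.inr (i, C)))

theorem sum_pack_mul_sub (a b : Fin n → ℝ) (d : Fin n → Finset (Fin n) → ℝ)
    (x v : Fin n → ℝ) (q : Fin n → Finset (Fin n) → ℝ) (z : Coord n → ℝ) :
    ∑ t, pack a b d t * (pack x v q t - z t) =
      ∑ i, a i * (x i - effort z i) + (∑ i, b i * (v i - value z i) +
        ∑ i, ∑ C, d i C * (q i C - mix z i C)) := by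
  simp only [Fintype.sum_sum_type, Fintype.sum_prod_type, pack, Sum.elim_inl, Sum.elim_inr,
    effort, value, mix]

end Coord

namespace RegularGame
open Coord
variable {n : ℕ} (G : RegularGame n)

/-- The domain of the fixed point problem: total output is at least `s`. -/
def domain (s : ℝ) : Set (Coord n → ℝ) :=
  {z | (∀ i, effort z i ∈ Icc 0 (G.X i)) ∧ s ≤ ∑ i, G.output (effort z) i ∧
    G.IsBargain (value z) (mix z)}

/-- The expected payoff from the effort profile `x`. -/
noncomputable def netValue (x v : Fin n → ℝ) (q : Fin n → Finset (Fin n) → ℝ) (i : Fin n) : ℝ :=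
  (∑ j, G.output x j * G.reward v q j i) / ∑ j, G.output x j - G.c i (x i)

/-- The marginal cost of output minus its marginal return, scaled by the square of total output. -/
def marginalLoss (x v : Fin n → ℝ) (q : Fin n → Finset (Fin n) → ℝ) (i : Fin n) : ℝ :=
  (∑ j, G.output x j) ^ 2 * G.r i (x i) - G.α i * G.stake x v q i

/-- The vector field of the variational inequality. -/
noncomputable def field (z : Coord n → ℝ) : Coord n → ℝ :=
  pack (G.marginalLoss (effort z) (value z) (mix z))
    (fun i => value z i - G.netValue (effort z) (value z) (mix z) i)
    (fun _ C => G.price (value z) C)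

theorem isBargain_iff (v : Fin n → ℝ) (q : Fin n → Finset (Fin n) → ℝ) : G.IsBargain v q ↔
    (∀ i, 0 ≤ v i) ∧ ∑ i, v i ≤ 1 ∧ (∀ i C, 0 ≤ q i C) ∧ (∀ i, ∑ C, q i C = 1) ∧
      ∀ i C, ¬ (i ∉ C ∧ C.card + 1 = G.k) → q i C = 0 :=
  ⟨fun h => ⟨h.1, h.2, h.3, h.4, h.5⟩, fun h => ⟨h.1, h.2.1, h.2.2.1, h.2.2.2.1, h.2.2.2.2⟩⟩

theorem continuous_effort (i : Fin n) : Continuous fun z : Coord n → ℝ => effort z i :=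
  continuous_apply _

theorem continuous_value (i : Fin n) : Continuous fun z : Coord n → ℝ => value z i :=
  continuous_apply _

theorem continuous_mix (i : Fin n) (C : Finset (Fin n)) :
    Continuous fun z : Coord n → ℝ => mix z i C :=
  continuous_apply _

theorem continuous_output (i : Fin n) : Continuous fun z : Coord n → ℝ => G.output (effort z) i :=
  (continuous_const.mul ((G.f_continuous i).comp (continuous_effort i))).add continuous_const

theorem continuous_price (C : Finset (Fin n)) :
    Continuous fun z : Coord n → ℝ => G.price (value z) C :=
  continuous_finsetSum _ fun j _ => continuous_const.mul (continuous_value j)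

theorem continuous_reward (j i : Fin n) :
    Continuous fun z : Coord n → ℝ => G.reward (value z) (mix z) j i := by
  unfold Game.reward
  split_ifs
  · exact continuous_const.sub (continuous_finsetSum _ fun C _ =>
      (continuous_mix i C).mul (G.continuous_price C))
  · exact (continuous_finsetSum _ fun C _ => continuous_mix j C).mul
      (continuous_const.mul (continuous_value i))

theorem isCompact_domain (s : ℝ) : IsCompact (G.domain s) := by
  refine (isCompact_univ_pi (s := Sum.elim (fun i => Icc 0 (G.X i)) fun _ => Icc 0 1)
    ?_).of_isClosed_subset ?_ ?_
  · rintro (i | i) <;> exact isCompact_Icc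
  · simp only [domain, isBargain_iff, mem_Icc, ofPred_and, ofPred_forall]
    refine IsClosed.inter (isClosed_iInter fun i => IsClosed.inter ?_ ?_) (IsClosed.inter ?_ ?_)
    · exact isClosed_le continuous_const (continuous_effort i)
    · exact isClosed_le (continuous_effort i) continuous_const
    · exact isClosed_le continuous_const (continuous_finsetSum _ fun i _ => G.continuous_output i)
    refine IsClosed.inter (isClosed_iInter fun i => ?_) (IsClosed.inter ?_ (IsClosed.inter
      (isClosed_iInter fun i => isClosed_iInter fun C => ?_) (IsClosed.inter
      (isClosed_iInter fun i => ?_) (isClosed_iInter fun i => isClosed_iInter fun C =>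
        isClosed_iInter fun _ => ?_))))
    · exact isClosed_le continuous_const (continuous_value i)
    · exact isClosed_le (continuous_finsetSum _ fun i _ => continuous_value i) continuous_const
    · exact isClosed_le continuous_const (continuous_mix i C)
    · exact isClosed_eq (continuous_finsetSum _ fun C _ => continuous_mix i C) continuous_const
    · exact isClosed_eq (continuous_mix i C) continuous_const
  · rintro z ⟨hx, -, hb⟩ (i | i | ⟨i, C⟩) -
    · exact hx i
    · exact ⟨hb.v_nonneg i, (Finset.single_le_sum (fun j _ => hb.v_nonneg j)
        (Finset.mem_univ i)).trans hb.v_sum⟩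
    · exact ⟨hb.q_nonneg i C, (Finset.single_le_sum (fun D _ => hb.q_nonneg i D)
        (Finset.mem_univ C)).trans (hb.q_sum i).le⟩

/-- Total output is a concave function of efforts, so bounding it from below preserves convexity;
all other constraints are linear. -/
theorem convex_domain (s : ℝ) : Convex ℝ (G.domain s) := by
  rintro z ⟨hx, hs, hb⟩ z' ⟨hx', hs', hb'⟩ a b ha hb0 hab
  have he : ∀ i, effort (a • z + b • z') i = a * effort z i + b * effort z' i := fun _ => rfl
  have hv : ∀ i, value (a • z + b • z') i = a * value z i + b * value z' i := fun _ => rfl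
  have hq : ∀ i C, mix (a • z + b • z') i C = a * mix z i C + b * mix z' i C := fun _ _ => rfl
  refine ⟨fun i => (convex_Icc 0 (G.X i)) (hx i) (hx' i) ha hb0 hab, ?_, ?_⟩
  · have key : ∀ i, a * G.output (effort z) i + b * G.output (effort z') i ≤
        G.output (effort (a • z + b • z')) i := by
      intro i
      have := (G.f_concave i).2 (mem_Ici.2 (hx i).1) (mem_Ici.2 (hx' i).1) ha hb0 hab
      simp only [smul_eq_mul] at this
      simp only [Game.output, he]
      have hβ : a * G.β i + b * G.β i = G.β i := by rw [← add_mul, hab, one_mul]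
      linarith [mul_le_mul_of_nonneg_left this (G.α_nonneg i)]
    calc s = a * s + b * s := by rw [← add_mul, hab, one_mul]
      _ ≤ a * ∑ i, G.output (effort z) i + b * ∑ i, G.output (effort z') i :=
          add_le_add (mul_le_mul_of_nonneg_left hs ha) (mul_le_mul_of_nonneg_left hs' hb0)
      _ = ∑ i, (a * G.output (effort z) i + b * G.output (effort z') i) := by
          rw [Finset.sum_add_distrib, Finset.mul_sum, Finset.mul_sum]
      _ ≤ _ := Finset.sum_le_sum fun i _ => key i
  · refine ⟨fun i => ?_, ?_, fun i C => ?_, fun i => ?_, fun i C hC => ?_⟩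
    · rw [hv]
      exact add_nonneg (mul_nonneg ha (hb.v_nonneg i)) (mul_nonneg hb0 (hb'.v_nonneg i))
    · simp only [hv, Finset.sum_add_distrib, ← Finset.mul_sum]
      nlinarith [mul_le_mul_of_nonneg_left hb.v_sum ha, mul_le_mul_of_nonneg_left hb'.v_sum hb0]
    · rw [hq]
      exact add_nonneg (mul_nonneg ha (hb.q_nonneg i C)) (mul_nonneg hb0 (hb'.q_nonneg i C))
    · simp only [hq, Finset.sum_add_distrib, ← Finset.mul_sum, hb.q_sum, hb'.q_sum, mul_one, hab]
    · rw [hq, hb.q_eq_zero i C hC, hb'.q_eq_zero i C hC]; simp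

theorem exists_isBargain : ∃ v q, G.IsBargain v q := by
  have hC : ∀ i : Fin n, ∃ C : Finset (Fin n), i ∉ C ∧ C.card + 1 = G.k := by
    intro i
    have hcard : G.k - 1 ≤ (Finset.univ.erase i).card := by
      rw [Finset.card_erase_of_mem (Finset.mem_univ i), Finset.card_univ, Fintype.card_fin]
      have := G.k_le
      omega
    obtain ⟨C, hC, hcard⟩ := Finset.exists_subset_card_eq hcard
    exact ⟨C, fun h => Finset.notMem_erase i _ (hC h), by have := G.k_pos; omega⟩
  choose C hC using hC
  refine ⟨fun _ => 0, fun i => Pi.single (C i) 1, fun _ => le_rfl, by simp, fun i D => ?_,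
    fun i => by simp, fun i D hD => Pi.single_eq_of_ne ?_ _⟩
  · exact (Pi.single_nonneg.2 zero_le_one : (0 : Finset (Fin n) → ℝ) ≤ Pi.single (C i) 1) D
  · rintro rfl; exact hD (hC i)

theorem continuousOn_field {s : ℝ} (hs : 0 < s) : ContinuousOn G.field (G.domain s) := by
  have hsum : Continuous fun z : Coord n → ℝ => ∑ j, G.output (effort z) j :=
    continuous_finsetSum _ fun j _ => G.continuous_output j
  have hc : ∀ i, Continuous fun z : Coord n → ℝ => G.c i (effort z i) := fun i =>
    (G.c_continuous i).comp (continuous_effort i)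
  have hr : ∀ i, Continuous fun z : Coord n → ℝ => G.r i (effort z i) := fun i =>
    (G.r_continuous i).comp (continuous_effort i)
  refine continuousOn_pi.2 ?_
  rintro (i | i | ⟨i, C⟩)
  · refine Continuous.continuousOn (((hsum.pow 2).mul (hr i)).sub (continuous_const.mul ?_))
    exact continuous_finsetSum _ fun j _ => (G.continuous_output j).mul
      ((G.continuous_reward i i).sub (G.continuous_reward j i))
  · refine (continuous_value i).continuousOn.sub (ContinuousOn.sub (ContinuousOn.div
      (continuous_finsetSum _ fun j _ => (G.continuous_output j).mul
        (G.continuous_reward j i)).continuousOn hsum.continuousOn ?_) (hc i).continuousOn)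
    exact fun z hz => (hs.trans_le hz.2.1).ne'
  · exact (G.continuous_price C).continuousOn

/-- The variational inequality, split into its three components. -/
theorem exists_variational_solution {s : ℝ} (hs : 0 < s) (hX : s ≤ ∑ i, G.output G.X i) :
    ∃ x v q, (∀ i, x i ∈ Icc 0 (G.X i)) ∧ s ≤ ∑ i, G.output x i ∧ G.IsBargain v q ∧
      (∀ i, ∀ t ∈ Icc 0 (G.X i), s ≤ ∑ j, G.output (Function.update x i t) j →
        0 ≤ G.marginalLoss x v q i * (t - x i)) ∧
      (∀ v' : Fin n → ℝ, (∀ i, 0 ≤ v' i) → ∑ i, v' i ≤ 1 →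
        0 ≤ ∑ i, (v i - G.netValue x v q i) * (v' i - v i)) ∧
      (∀ i C, i ∉ C → C.card + 1 = G.k → ∑ D, q i D * G.price v D ≤ G.price v C) := by
  obtain ⟨v₀, q₀, hb₀⟩ := G.exists_isBargain
  obtain ⟨z, ⟨hx, hS, hb⟩, hz⟩ := exists_variationalInequality (K := G.domain s)
    ⟨pack G.X v₀ q₀, fun i => ⟨(G.X_pos i).le, le_rfl⟩, hX, hb₀⟩ (G.isCompact_domain s)
    (G.convex_domain s) (G.continuousOn_field hs)
  have hz' : ∀ x v q, (∀ i, x i ∈ Icc 0 (G.X i)) → s ≤ ∑ i, G.output x i → G.IsBargain v q →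
      0 ≤ ∑ i, G.marginalLoss (effort z) (value z) (mix z) i * (x i - effort z i) +
        (∑ i, (value z i - G.netValue (effort z) (value z) (mix z) i) * (v i - value z i) +
        ∑ i, ∑ C, G.price (value z) C * (q i C - mix z i C)) := by
    intro x v q h1 h2 h3
    have := hz (pack x v q) ⟨h1, h2, h3⟩
    rwa [field, sum_pack_mul_sub] at this
  -- Test points that differ from `z` in one effort, in the values, or in one agent's mixture (moved
  -- to a point mass) isolate the corresponding block.
  refine ⟨effort z, value z, mix z, hx, hS, hb, fun i t ht hst => ?_, fun v' h0 h1 => ?_,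
    fun i C hi hC => ?_⟩
  · have := hz' (Function.update (effort z) i t) (value z) (mix z) (fun j => ?_) hst hb
    · simp only [sub_self, mul_zero, Finset.sum_const_zero, add_zero] at this
      rw [Finset.sum_eq_single i] at this
      · simpa using this
      · intro j _ hj; simp [Function.update_of_ne hj]
      · simp
    · by_cases hj : j = i
      · subst hj; simpa using ht
      · rw [Function.update_of_ne hj]; exact hx j
  · have := hz' (effort z) v' (mix z) hx hS ⟨h0, h1, hb.q_nonneg, hb.q_sum, hb.q_eq_zero⟩
    simpa only [sub_self, mul_zero, Finset.sum_const_zero, add_zero, zero_add] using this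
  · have := hz' (effort z) (value z) (Function.update (mix z) i (Pi.single C 1)) hx hS
      ⟨hb.v_nonneg, hb.v_sum, fun j D => ?_, fun j => ?_, fun j D hD => ?_⟩
    · simp only [sub_self, mul_zero, Finset.sum_const_zero, zero_add] at this
      rw [Finset.sum_eq_single i] at this
      · simp only [Function.update_self, mul_sub, Finset.sum_sub_distrib] at this
        simp only [Pi.single_apply, mul_ite, mul_one, mul_zero, Finset.sum_ite_eq',
          Finset.mem_univ, if_true] at this
        simp only [mul_comm (mix z i _)]
        linarith
      · intro j _ hj; simp [Function.update_of_ne hj]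
      · simp
    · by_cases hj : j = i
      · subst hj
        rw [Function.update_self]
        exact (Pi.single_nonneg.2 zero_le_one : (0 : Finset (Fin n) → ℝ) ≤ Pi.single C 1) D
      · rw [Function.update_of_ne hj]; exact hb.q_nonneg j D
    · by_cases hj : j = i
      · subst hj; simp
      · rw [Function.update_of_ne hj]; exact hb.q_sum j
    · by_cases hj : j = i
      · subst hj
        rw [Function.update_self]
        refine Pi.single_eq_of_ne ?_ _
        rintro rfl; exact hD ⟨hi, hC⟩
      · rw [Function.update_of_ne hj]; exact hb.q_eq_zero j D hD

end RegularGame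
end Bargaining

end

/-! ### From the variational inequality to an equilibrium of one period -/

section
open Set Filter Topology
namespace Bargaining
namespace RegularGame
variable {n : ℕ} (G : RegularGame n)

theorem netValue_eq {x v : Fin n → ℝ} {q : Fin n → Finset (Fin n) → ℝ}
    (hS : 0 < ∑ j, G.output x j) (i : Fin n) :
    G.netValue x v q i =
      G.reward v q i i - G.stake x v q i / (∑ j, G.output x j) - G.c i (x i) := by
  rw [netValue, G.sum_output_mul_reward, sub_div, mul_div_cancel_left₀ _ hS.ne']

/-- With headstarts, `s` is their sum and never constrains efforts. Otherwise `s` is so small that,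
at total output `s`, each of two competitors would gain from extra output if the others produced at
least `s / 2`, and that either of them at the cap `X i` would alone produce more than `s`. -/
theorem exists_output_bound
    (hnd : 0 < ∑ i, G.β i ∨ ∃ a b, a ≠ b ∧ 0 < G.α a ∧ 0 < G.α b) :
    ∃ s, 0 < s ∧ s ≤ ∑ i, G.output G.X i ∧
      ((∀ x : Fin n → ℝ, (∀ i, 0 ≤ x i) → s ≤ ∑ i, G.output x i) ∨
        ∃ a b, a ≠ b ∧ ∀ i, i = a ∨ i = b → 0 < G.α i ∧ s * G.r i (G.X i) < G.α i * G.η / 2 ∧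
          s < G.α i * G.f i (G.X i)) := by
  rcases hnd with h | ⟨a, b, hab, ha, hb⟩
  · have key : ∀ x : Fin n → ℝ, (∀ i, 0 ≤ x i) → ∑ i, G.β i ≤ ∑ i, G.output x i := fun x hx =>
      Finset.sum_le_sum fun i _ =>
        le_add_of_nonneg_left (mul_nonneg (G.α_nonneg i) (G.f_nonneg i (hx i)))
    exact ⟨_, h, key _ fun i => (G.X_pos i).le, Or.inl key⟩
  · have key : ∀ i, 0 < G.α i → ∃ m, 0 < m ∧ ∀ s, s ≤ m →
        s * G.r i (G.X i) < G.α i * G.η / 2 ∧ s < G.α i * G.f i (G.X i) := by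
      intro i hi
      have hf : 0 < G.f i (G.X i) := by
        have := G.f_mono i (mem_Ici.2 le_rfl) (mem_Ici.2 (G.X_pos i).le) (G.X_pos i)
        rwa [G.f_zero] at this
      have hr := G.r_pos i _ (G.X_pos i)
      have hη := G.η_pos
      -- Half of each admissible bound, so that the required inequalities are strict.
      refine ⟨min (G.α i * G.η / 4 / G.r i (G.X i)) (G.α i * G.f i (G.X i) / 2), by positivity,
        fun s hs => ⟨?_, ?_⟩⟩
      · have h1 := hs.trans (min_le_left _ _)
        rw [le_div_iff₀ hr] at h1
        have : 0 < G.α i * G.η := by positivity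
        linarith
      · have h1 := hs.trans (min_le_right _ _)
        have : 0 < G.α i * G.f i (G.X i) := by positivity
        linarith
    obtain ⟨ma, hma, hma'⟩ := key a ha
    obtain ⟨mb, hmb, hmb'⟩ := key b hb
    have hX : ∀ i, 0 ≤ G.X i := fun i => (G.X_pos i).le
    refine ⟨min ma mb, lt_min hma hmb, ?_, Or.inr ⟨a, b, hab, ?_⟩⟩
    · calc min ma mb ≤ G.output G.X a :=
            (hma' _ (min_le_left _ _)).2.le.trans (le_add_of_nonneg_right (G.β_nonneg a))
        _ ≤ _ := Finset.single_le_sum (fun i _ => G.output_nonneg hX i) (Finset.mem_univ a)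
    · rintro i (rfl | rfl)
      · exact ⟨ha, hma' _ (min_le_left _ _)⟩
      · exact ⟨hb, hmb' _ (min_le_right _ _)⟩

theorem sum_output_le_update {x : Fin n → ℝ} {i : Fin n} {t : ℝ} (hx : 0 ≤ x i) (ht : x i ≤ t) :
    ∑ j, G.output x j ≤ ∑ j, G.output (Function.update x i t) j := by
  rw [G.sum_output_update]
  have := (G.f_mono i).monotoneOn (mem_Ici.2 hx) (mem_Ici.2 (hx.trans ht)) ht
  exact le_add_of_nonneg_right (mul_nonneg (G.α_nonneg i) (sub_nonneg.2 this))

/-- Agents who compete do not let total output fall to a low bound. -/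
theorem lt_sum_output {x v : Fin n → ℝ} {q : Fin n → Finset (Fin n) → ℝ} {s : ℝ} (hs : 0 < s)
    (hx : ∀ i, x i ∈ Icc 0 (G.X i)) (hS : s ≤ ∑ i, G.output x i) (hb : G.IsBargain v q)
    (hvi : ∀ i, ∀ t ∈ Icc 0 (G.X i), s ≤ ∑ j, G.output (Function.update x i t) j →
        0 ≤ G.marginalLoss x v q i * (t - x i)) {a b : Fin n} (hab : a ≠ b)
    (h : ∀ i, i = a ∨ i = b → 0 < G.α i ∧ s * G.r i (G.X i) < G.α i * G.η / 2 ∧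
          s < G.α i * G.f i (G.X i)) : s < ∑ i, G.output x i := by
  have hx0 : ∀ i, 0 ≤ x i := fun i => (hx i).1
  refine lt_of_le_of_ne hS fun hSs => ?_
  -- One of the two competitors produces at most half of `s`. His stake is at least `η * s / 2` and
  -- his effort is below the cap, so raising it would violate the variational inequality.
  obtain ⟨i, hi, hout⟩ : ∃ i, (i = a ∨ i = b) ∧ G.output x i ≤ s / 2 := by
    by_contra! hcon
    have h1 := hcon a (Or.inl rfl)
    have h2 := hcon b (Or.inr rfl)
    have h3 : ∑ i ∈ {a, b}, G.output x i ≤ ∑ i, G.output x i :=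
      Finset.sum_le_sum_of_subset_of_nonneg (Finset.subset_univ _)
        fun j _ _ => G.output_nonneg hx0 j
    rw [Finset.sum_pair hab] at h3
    linarith
  obtain ⟨hα, hr, hf⟩ := h i hi
  have hlt : x i < G.X i := by
    refine lt_of_le_of_ne (hx i).2 fun he => ?_
    have : G.output x i = G.α i * G.f i (G.X i) + G.β i := by rw [Game.output, he]
    linarith [G.β_nonneg i]
  have hvi' := hvi i (G.X i) ⟨(G.X_pos i).le, le_rfl⟩
    (hS.trans (G.sum_output_le_update (hx0 i) hlt.le))
  have hloss : G.marginalLoss x v q i < 0 := by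
    rw [marginalLoss, ← hSs]
    have h1 := G.le_stake hb hx0 i
    rw [← hSs] at h1
    have h2 := G.r_mono i (mem_Ici.2 (hx0 i)) (mem_Ici.2 (G.X_pos i).le) hlt.le
    have h3 : G.η * (s / 2) ≤ G.stake x v q i :=
      (mul_le_mul_of_nonneg_left (by linarith) G.η_pos.le).trans h1
    have h4 : s ^ 2 * G.r i (x i) ≤ s * (s * G.r i (G.X i)) := by
      rw [sq, mul_assoc]
      exact mul_le_mul_of_nonneg_left (mul_le_mul_of_nonneg_left h2 hs.le) hs.le
    have h5 := mul_lt_mul_of_pos_left hr hs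
    have h6 := mul_le_mul_of_nonneg_left h3 hα.le
    nlinarith
  nlinarith [mul_neg_of_neg_of_pos hloss (sub_pos.2 hlt)]

/-- The variational solution satisfies exact equilibrium conditions once neither artificial
constraint matters: the output bound does not prevent reducing effort, and effort above `X i` costs
more than the whole dollar. -/
theorem exists_equilibrium
    (hnd : 0 < ∑ i, G.β i ∨ ∃ a b, a ≠ b ∧ 0 < G.α a ∧ 0 < G.α b) :
    ∃ x v q, (∀ i, 0 ≤ x i) ∧ 0 < ∑ i, G.output x i ∧ G.IsBargain v q ∧
      (∀ i C, q i C ≠ 0 → G.IsLeastCostCoalition v i C) ∧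
      (∀ i, G.netValue x v q i = v i) ∧
      ∀ i y, 0 ≤ y → 0 < ∑ j, G.output (Function.update x i y) j ∧
        G.netValue (Function.update x i y) v q i ≤ v i := by
  obtain ⟨s, hs, hX, hcase⟩ := G.exists_output_bound hnd
  obtain ⟨x, v, q, hx, hS, hb, hvx, hvv, hvq⟩ := G.exists_variational_solution hs hX
  have hx0 : ∀ i, 0 ≤ x i := fun i => (hx i).1
  have hS0 : 0 < ∑ i, G.output x i := hs.trans_le hS
  have hup : ∀ i, x i < G.X i → 0 ≤ G.marginalLoss x v q i := by
    intro i hi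
    have := hvx i (G.X i) ⟨(G.X_pos i).le, le_rfl⟩
      (hS.trans (G.sum_output_le_update (hx0 i) hi.le))
    exact nonneg_of_mul_nonneg_left this (sub_pos.2 hi)
  have hdown : ∀ i, 0 < x i → G.marginalLoss x v q i ≤ 0 := by
    intro i hi
    -- A lower effort that keeps total output above `s`: zero if headstarts suffice, and a slightly
    -- smaller effort if the bound is slack.
    obtain ⟨t, ht0, htx, hst⟩ : ∃ t, 0 ≤ t ∧ t < x i ∧
        s ≤ ∑ j, G.output (Function.update x i t) j := by
      rcases hcase with h | ⟨a, b, hab, h⟩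
      · refine ⟨0, le_rfl, hi, h _ fun j => ?_⟩
        by_cases hj : j = i
        · subst hj; simp
        · rw [Function.update_of_ne hj]; exact hx0 j
      · have hlt := G.lt_sum_output hs hx hS hb hvx hab h
        have hcont : Continuous fun t => ∑ j, G.output x j + G.α i * (G.f i t - G.f i (x i)) :=
          continuous_const.add (continuous_const.mul ((G.f_continuous i).sub continuous_const))
        have hev : ∀ᶠ t in 𝓝 (x i), s < ∑ j, G.output x j + G.α i * (G.f i t - G.f i (x i)) :=
          hcont.continuousAt.eventually (lt_mem_nhds (by simpa using hlt))
        obtain ⟨t, ht, ht'⟩ := ((hev.filter_mono nhdsWithin_le_nhds).and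
          (Ioo_mem_nhdsLT hi)).exists
        exact ⟨t, ht'.1.le, ht'.2, by rw [G.sum_output_update]; exact ht.le⟩
    have := hvx i t ⟨ht0, htx.le.trans (hx i).2⟩ hst
    by_contra! hpos
    nlinarith [mul_pos hpos (sub_pos.2 htx)]
  -- Output remains positive without the effort of `i`. Otherwise he would be the sole producer,
  -- with zero stake and positive effort, and would strictly save by reducing it. Thus every
  -- unilateral deviation avoids the discontinuity at zero output.
  have hR : ∀ i, 0 < ∑ j, G.output x j - G.α i * G.f i (x i) := by
    intro i
    have hR' : ∑ j, G.output (Function.update x i 0) j =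
        ∑ j, G.output x j - G.α i * G.f i (x i) := by
      rw [G.sum_output_update, G.f_zero]; ring
    have hnn : ∀ j, 0 ≤ G.output (Function.update x i 0) j := by
      refine G.output_nonneg fun j => ?_
      by_cases hj : j = i
      · subst hj; simp
      · rw [Function.update_of_ne hj]; exact hx0 j
    rw [← hR']
    refine lt_of_le_of_ne (Finset.sum_nonneg fun j _ => hnn j) fun h0 => ?_
    have hzero := (Finset.sum_eq_zero_iff_of_nonneg fun j _ => hnn j).1 h0.symm
    have hstake : G.stake x v q i = 0 := by
      rw [← G.stake_update x i 0]
      exact Finset.sum_eq_zero fun j hj => by rw [hzero j hj, zero_mul]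
    have hxi : 0 < x i := by
      refine lt_of_le_of_ne (hx0 i) fun hxi => ?_
      rw [hR', ← hxi, G.f_zero] at h0
      linarith
    have h1 := hdown i hxi
    rw [marginalLoss, hstake] at h1
    have h2 := G.r_pos i _ hxi
    nlinarith [mul_pos (pow_pos hS0 2) h2]
  have hSy : ∀ i y, ∑ j, G.output (Function.update x i y) j =
      ∑ j, G.output x j - G.α i * G.f i (x i) + G.α i * G.f i y := fun i y => by
    rw [G.sum_output_update]; ring
  have hSy0 : ∀ i y, 0 ≤ y → 0 < ∑ j, G.output (Function.update x i y) j := fun i y hy => by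
    rw [hSy]; linarith [hR i, mul_nonneg (G.α_nonneg i) (G.f_nonneg i hy)]
  have hnet : ∀ i y, 0 ≤ y → G.netValue (Function.update x i y) v q i = G.reward v q i i +
      (-(G.stake x v q i / (∑ j, G.output x j - G.α i * G.f i (x i) + G.α i * G.f i y)) -
        G.c i y) := fun i y hy => by
    rw [G.netValue_eq (hSy0 i y hy), G.stake_update, Function.update_self, hSy]; ring
  have hnetx : ∀ i, G.netValue x v q i = G.netValue (Function.update x i (x i)) v q i := fun i => by
    rw [Function.update_eq_self]
  have hopt : ∀ i y, 0 ≤ y → y ≤ G.X i →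
      G.netValue (Function.update x i y) v q i ≤ G.netValue x v q i := by
    intro i y hy hyX
    rw [hnetx, hnet i y hy, hnet i _ (hx0 i)]
    refine add_le_add_right (G.effort_optimal i (G.stake_nonneg hb hx0 i) (hR i) (hx0 i) hy
      (fun hxy => ?_) fun hpos => ?_) _
    · rw [sub_add_cancel]
      have := hup i (hxy.trans_le hyX)
      rw [marginalLoss] at this; linarith
    · rw [sub_add_cancel]
      have := hdown i hpos
      rw [marginalLoss] at this; linarith
  have hnn : ∀ i, 0 ≤ G.netValue x v q i := by
    intro i
    refine le_trans ?_ (hopt i 0 le_rfl (G.X_pos i).le)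
    rw [netValue, Function.update_self, G.c_zero, sub_zero]
    refine div_nonneg (Finset.sum_nonneg fun j _ => mul_nonneg ?_ (hb.reward_nonneg j i))
      (hSy0 i 0 le_rfl).le
    refine G.output_nonneg (fun j => ?_) j
    by_cases hj : j = i
    · subst hj; simp
    · rw [Function.update_of_ne hj]; exact hx0 j
  have hoptall : ∀ i y, 0 ≤ y →
      G.netValue (Function.update x i y) v q i ≤ G.netValue x v q i := by
    intro i y hy
    rcases le_or_gt y (G.X i) with h | h
    · exact hopt i y hy h
    · refine le_trans ?_ (hnn i)
      rw [hnet i y hy]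
      have h1 := G.c_large i y h
      have h2 := hb.reward_self_le_one i
      have h3 : 0 ≤ G.stake x v q i /
          (∑ j, G.output x j - G.α i * G.f i (x i) + G.α i * G.f i y) := by
        rw [← hSy]; exact div_nonneg (G.stake_nonneg hb hx0 i) (hSy0 i y hy).le
      linarith
  have hsum : ∑ i, G.netValue x v q i ≤ 1 := by
    have h1 : ∑ i, (∑ j, G.output x j * G.reward v q j i) / ∑ j, G.output x j = 1 := by
      rw [← Finset.sum_div, Finset.sum_comm]
      simp_rw [← Finset.mul_sum, hb.sum_reward, mul_one]
      exact div_self hS0.ne'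
    have h2 : 0 ≤ ∑ i, G.c i (x i) := Finset.sum_nonneg fun i _ => G.c_nonneg i _ (hx0 i)
    simp only [netValue, Finset.sum_sub_distrib]
    linarith
  -- Testing the value block with the net payoffs themselves makes it minus a sum of squares, which
  -- must vanish.
  have hv : ∀ i, G.netValue x v q i = v i := by
    have h1 := hvv (G.netValue x v q) hnn hsum
    have h2 : ∑ i, (v i - G.netValue x v q i) * (G.netValue x v q i - v i) =
        -∑ i, (v i - G.netValue x v q i) ^ 2 := by
      rw [← Finset.sum_neg_distrib]
      exact Finset.sum_congr rfl fun i _ => by ring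
    have h3 : ∑ i, (v i - G.netValue x v q i) ^ 2 = 0 :=
      le_antisymm (by linarith) (Finset.sum_nonneg fun i _ => sq_nonneg _)
    intro i
    have := (Finset.sum_eq_zero_iff_of_nonneg fun i _ => sq_nonneg _).1 h3 i (Finset.mem_univ i)
    have := pow_eq_zero_iff two_ne_zero |>.1 this
    linarith
  refine ⟨x, v, q, hx0, hS0, hb, fun i C hC => ?_, hv, fun i y hy =>
    ⟨hSy0 i y hy, (hoptall i y hy).trans_eq (hv i)⟩⟩
  have hvalid : i ∉ C ∧ C.card + 1 = G.k := by
    by_contra h; exact hC (hb.q_eq_zero i C h)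
  -- The mean price does not exceed the price of any feasible coalition, so every coalition of
  -- positive weight costs exactly the mean.
  set m := ∑ D, q i D * G.price v D with hm
  have hterm : ∀ D ∈ Finset.univ, 0 ≤ q i D * (G.price v D - m) := by
    intro D _
    by_cases hD : i ∉ D ∧ D.card + 1 = G.k
    · exact mul_nonneg (hb.q_nonneg i D) (sub_nonneg.2 (hvq i D hD.1 hD.2))
    · simp [hb.q_eq_zero i D hD]
  have hzero : ∑ D, q i D * (G.price v D - m) = 0 := by
    simp only [mul_sub, Finset.sum_sub_distrib, ← Finset.sum_mul, hb.q_sum, one_mul]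
    rw [← hm, sub_self]
  have h1 := (Finset.sum_eq_zero_iff_of_nonneg hterm).1 hzero C (Finset.mem_univ C)
  have h2 : G.price v C = m := sub_eq_zero.1 ((mul_eq_zero.1 h1).resolve_left hC)
  exact ⟨hvalid.1, hvalid.2, fun D hD hD' => h2.trans_le (hvq i D hD hD')⟩

end RegularGame
end Bargaining

end

/-! ### Equilibrium conditions for the original game -/

section
open Set Filter Topology
open scoped NNReal ENNReal
namespace Bargaining
namespace Game
variable {n : ℕ} (G : Game n)

/-- Efforts, values and coalition probabilities that satisfy the equilibrium conditions. -/
structure IsEquilibriumData (x : Fin n → ℝ≥0) (v : Fin n → ℝ)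
    (q : Fin n → Finset (Fin n) → ℝ) : Prop where
  v_nonneg : ∀ i, 0 ≤ v i
  price_add_le : ∀ i C, i ∉ C → G.price v C + G.δ i * v i ≤ 1
  q_nonneg : ∀ i C, 0 ≤ q i C
  q_sum : ∀ i, ∑ C, q i C = 1
  leastCost : ∀ i C, q i C ≠ 0 → G.IsLeastCostCoalition v i C
  value_eq : ∀ i, ∑ j, G.recognition x j * G.reward v q j i - G.c i (x i) = v i
  effort_opt : ∀ i (y : ℝ≥0),
    ∑ j, G.recognition (Function.update x i y) j * G.reward v q j i - G.c i y ≤ v i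

/-- Identically zero impacts give uniform recognition, and so do headstarts all equal to one. Thus
the case without any contest is absorbed into the case of positive headstarts. -/
theorem exists_nondegenerate_headstart (hα : ∀ i, 0 ≤ G.α i) (hβ : ∀ i, 0 ≤ G.β i) (hn : 0 < n)
    (hcontest : ¬ ((∀ i, G.β i = 0) ∧ ∃! i, 0 < G.α i)) :
    ∃ β' : Fin n → ℝ, (∀ i, 0 ≤ β' i) ∧
      (0 < ∑ i, β' i ∨ ∃ a b, a ≠ b ∧ 0 < G.α a ∧ 0 < G.α b) ∧
      ∀ x i, ({ G with β := β' } : Game n).recognition x i = G.recognition x i := by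
  by_cases h : 0 < ∑ i, G.β i
  · exact ⟨G.β, hβ, Or.inl h, fun _ _ => rfl⟩
  have hβ0 : ∀ i, G.β i = 0 := by
    have : ∑ i, G.β i = 0 := le_antisymm (not_lt.1 h) (Finset.sum_nonneg fun i _ => hβ i)
    exact fun i => (Finset.sum_eq_zero_iff_of_nonneg fun i _ => hβ i).1 this i (Finset.mem_univ i)
  by_cases h' : ∃ a, 0 < G.α a
  · obtain ⟨a, ha⟩ := h'
    have : ∃ b, a ≠ b ∧ 0 < G.α b := by
      by_contra! hcon
      refine hcontest ⟨hβ0, a, ha, fun b hb => ?_⟩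
      by_contra hne
      exact (hcon b (Ne.symm hne)).not_gt hb
    obtain ⟨b, hab, hb⟩ := this
    exact ⟨G.β, hβ, Or.inr ⟨a, b, hab, ha, hb⟩, fun _ _ => rfl⟩
  · have hα0 : ∀ i, G.α i = 0 := fun i => le_antisymm (not_lt.1 fun hi => h' ⟨i, hi⟩) (hα i)
    have hn' : (0 : ℝ) < n := by exact_mod_cast hn
    refine ⟨fun _ => 1, fun _ => zero_le_one, Or.inl (by simpa using hn'), fun x i => ?_⟩
    simp [recognition, impact, hα0, hβ0, hn']

theorem exists_equilibriumData (hn : 0 < n) (hk1 : 1 ≤ G.k) (hkn : G.k ≤ n)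
    (hα : ∀ i, 0 ≤ G.α i) (hβ : ∀ i, 0 ≤ G.β i) (hδ : ∀ i, 0 < G.δ i ∧ G.δ i < 1)
    (hf : ∀ i, IsTechnology (G.f i)) (hc : ∀ i, IsEffortCost (G.c i))
    (hcontest : ¬ ((∀ i, G.β i = 0) ∧ ∃! i, 0 < G.α i)) :
    ∃ x v q, G.IsEquilibriumData x v q := by
  obtain ⟨β', hβ', hnd, hrec⟩ := G.exists_nondegenerate_headstart hα hβ hn hcontest
  choose r hr using fun i => exists_isMarginalCost (hf i) (hc i)
  choose X hX0 hX1 using fun i => (hc i).exists_one_lt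
  have : Nonempty (Fin n) := ⟨⟨0, hn⟩⟩
  obtain ⟨i₀, hi₀⟩ := Finite.exists_max G.δ
  have hmax : ∀ g : ℝ → ℝ, ContinuousOn g (Ici 0) → Continuous fun t => g (max t 0) := fun g hg =>
    hg.comp_continuous (continuous_id.max continuous_const) fun t => mem_Ici.2 (le_max_right t 0)
  have hpos : ∀ {g : ℝ → ℝ} {t : ℝ}, 0 ≤ t → g (max t 0) = g t := fun ht => by rw [max_eq_left ht]
  -- Precomposition with `max t 0` makes the functions continuous on the whole line without changing
  -- them at efforts. The margin `η` is taken from the largest discount factor.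
  let R : RegularGame n :=
    { f := fun i t => G.f i (max t 0)
      c := fun i t => G.c i (max t 0)
      α := G.α
      β := β'
      δ := G.δ
      k := G.k
      r := fun i t => r i (max t 0)
      X := X
      η := 1 - G.δ i₀
      α_nonneg := hα
      β_nonneg := hβ'
      δ_pos := fun i => (hδ i).1
      δ_le := fun i => by linarith [hi₀ i]
      η_pos := by linarith [(hδ i₀).2]
      f_continuous := fun i => hmax _ (hf i).1
      c_continuous := fun i => hmax _ (hc i).1
      r_continuous := fun i => hmax _ (hr i).continuousOn
      f_zero := fun i => by simp [(hf i).2.1]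
      f_mono := fun i => (hf i).strictMonoOn.congr fun t ht => (hpos ht).symm
      f_concave := fun i => (hf i).concaveOn.congr fun t ht => (hpos ht).symm
      c_zero := fun i => by simp [(hc i).2.1]
      c_nonneg := fun i t _ => (hc i).nonneg (le_max_right t 0)
      c_large := fun i t ht => by
        have h0 := (hX0 i).le
        simp only [max_eq_left (h0.trans ht.le)]
        exact (hX1 i).trans ((hc i).strictMonoOn (mem_Ici.2 h0) (mem_Ici.2 (h0.trans ht.le)) ht)
      X_pos := hX0
      r_mono := fun i => (hr i).monotoneOn.congr fun t ht => (hpos ht).symm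
      r_pos := fun i t ht => by simp only [max_eq_left ht.le]; exact (hr i).pos t ht
      r_mul_le := fun i s t hs ht => by
        simp only [max_eq_left hs, max_eq_left ht]; exact (hr i).mul_sub_le s t hs ht
      k_pos := hk1
      k_le := hkn }
  obtain ⟨x, v, q, hx, hS, hb, hq, hv, hopt⟩ := R.exists_equilibrium hnd
  have hrecR : ∀ (y : Fin n → ℝ≥0) (z : Fin n → ℝ), (∀ i, z i = y i) → 0 < ∑ j, R.output z j →
      ∀ i, R.netValue z v q i =
        ∑ j, G.recognition y j * G.reward v q j i - G.c i (y i) := by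
    intro y z hyz hpos' i
    have himp : ∀ j, R.output z j = ({ G with β := β' } : Game n).impact j (y j) := by
      intro j
      simp [Game.output, Game.impact, R, hyz]
    have hsum : ∑ j, R.output z j = ∑ j, ({ G with β := β' } : Game n).impact j (y j) :=
      Finset.sum_congr rfl fun j _ => himp j
    have hrew : ∀ j, R.reward v q j i = G.reward v q j i := fun j => rfl
    have hci : R.c i (z i) = G.c i (y i) := by simp [R, hyz]
    rw [RegularGame.netValue, Finset.sum_div, hci]
    congr 1
    refine Finset.sum_congr rfl fun j _ => ?_
    rw [← hrec y j, recognition, if_pos (hsum ▸ hpos'), ← hsum, ← himp, hrew]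
    ring
  obtain ⟨y, rfl⟩ : ∃ y : Fin n → ℝ≥0, x = fun i => (y i : ℝ) :=
    ⟨fun i => (x i).toNNReal, funext fun i => (Real.coe_toNNReal _ (hx i)).symm⟩
  refine ⟨y, v, q, hb.v_nonneg, fun i C hi => ?_, hb.q_nonneg, hb.q_sum, hq, fun i => ?_,
    fun i t => ?_⟩
  · have h1 : G.price v C + G.δ i * v i ≤ 1 - (1 - G.δ i₀) := hb.price_add_le hi
    linarith [(hδ i₀).2]
  · rw [← hv i, hrecR y _ (fun i => rfl) hS i]
  · have h := hopt i t t.2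
    rw [hrecR (Function.update y i t) _ (fun j => ?_) h.1 i, Function.update_self] at h
    · exact h.2
    · by_cases hj : j = i
      · subst hj; simp
      · simp only [Function.update_of_ne hj]

end Game
end Bargaining

end

/-! ### The stationary profile is a subgame perfect equilibrium -/

section
open Set Filter Topology
open scoped NNReal ENNReal
namespace Bargaining

theorem tsum_map_mul {A B : Type*} (p : PMF A) (g : A → B) (w : B → ℝ≥0∞) :
    ∑' b, p.map g b * w b = ∑' a, p a * w (g a) := by
  classical
  simp_rw [PMF.map_apply, ← ENNReal.tsum_mul_right]
  rw [ENNReal.tsum_comm]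
  refine tsum_congr fun a => ?_
  rw [tsum_eq_single (g a)]
  · simp
  · intro b hb; simp [hb]

theorem coe_ofReal_sub_ofReal {a b : ℝ} (ha : 0 ≤ a) (hb : 0 ≤ b) :
    ((ENNReal.ofReal a : ℝ≥0∞) : EReal) - ((ENNReal.ofReal b : ℝ≥0∞) : EReal) =
      ((a - b : ℝ) : EReal) := by
  rw [EReal.coe_ennreal_ofReal, EReal.coe_ennreal_ofReal, max_eq_left ha, max_eq_left hb,
    EReal.coe_sub]

theorem coe_sub_coe_le {A B : ℝ≥0∞} {b : ℝ} (hb : 0 ≤ b) (h : A ≤ ENNReal.ofReal b + B) :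
    (A : EReal) - (B : EReal) ≤ (b : EReal) := by
  refine EReal.sub_le_of_le_add ?_
  have h1 : (A : EReal) ≤ ((ENNReal.ofReal b + B : ℝ≥0∞) : EReal) :=
    EReal.coe_ennreal_le_coe_ennreal_iff.2 h
  rwa [EReal.coe_ennreal_add, EReal.coe_ennreal_ofReal, max_eq_left hb] at h1

namespace Game
variable {n : ℕ} (G : Game n)

/-- For play that certainly ends within the current period: the continuation function is then
immaterial. -/
theorem total_eq_of_iterate_succ {ρ : Profile n} {i : Fin n} {share : Proposal n → ℝ≥0∞}
    {flow : ℝ≥0 → ℝ≥0∞} {h : History n} {a : ℝ≥0∞}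
    (ha : ∀ W : History n → ℝ≥0∞, G.effortStep ρ i share flow W h = a) :
    G.total ρ i share flow h = a := by
  refine le_antisymm (iSup_le fun T => ?_) (le_iSup_of_le 1 (ha _).ge)
  cases T with
  | zero => exact zero_le
  | succ T => rw [Function.iterate_succ_apply']; exact (ha _).le

section Deviation
variable {G} {x : Fin n → ℝ≥0} {v : Fin n → ℝ} {q : Fin n → Finset (Fin n) → ℝ}

/-- The invariant compares gross payoff with a constant plus cost instead of bounding their
difference, since the cost of a deviation may be infinite. `W` and `W'` are the continuations of the
two streams. -/
theorem votingStep_le {ρ : Profile n} {i : Fin n} (hδ : 0 ≤ G.δ i) {W W' : History n → ℝ≥0∞}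
    {w : ℝ} (hW : ∀ h, W h ≤ ENNReal.ofReal w + W' h) {h : History n}
    {y : Fin n → ℝ≥0} {j : Fin n} {s : Proposal n} {b : ℝ}
    (happ : G.Approved j (fun l => (ρ l).vote h y j s) → (s : Fin n → ℝ) i ≤ b)
    (hrej : ¬ G.Approved j (fun l => (ρ l).vote h y j s) → G.δ i * w ≤ b) :
    G.votingStep ρ i (shareOf i) W h y j s ≤
      ENNReal.ofReal b + G.votingStep ρ i (fun _ => 0) W' h y j s := by
  unfold votingStep
  split_ifs with hA
  · rw [add_zero]; exact ENNReal.ofReal_le_ofReal (happ hA)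
  · calc _ ≤ ENNReal.ofReal (G.δ i) * (ENNReal.ofReal w + W' _) := mul_le_mul_right (hW _) _
      _ = ENNReal.ofReal (G.δ i * w) + ENNReal.ofReal (G.δ i) * W' _ := by
          rw [mul_add, ENNReal.ofReal_mul hδ]
      _ ≤ _ := add_le_add_left (ENNReal.ofReal_le_ofReal (hrej hA)) _

namespace IsEquilibriumData

theorem sum_ofReal (E : G.IsEquilibriumData x v q)
    (i : Fin n) : ∑ C, ENNReal.ofReal (q i C) = 1 := by
  rw [← ENNReal.ofReal_sum_of_nonneg fun C _ => E.q_nonneg i C, E.q_sum, ENNReal.ofReal_one]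

theorem mean_price (E : G.IsEquilibriumData x v q)
    (i : Fin n) {C : Finset (Fin n)} (hi : i ∉ C) (hC : C.card + 1 = G.k) :
    ∑ D, q i D * G.price v D ≤ G.price v C := by
  calc ∑ D, q i D * G.price v D ≤ ∑ D, q i D * G.price v C := by
        refine Finset.sum_le_sum fun D _ => ?_
        by_cases hD : q i D = 0
        · simp [hD]
        · exact mul_le_mul_of_nonneg_left ((E.leastCost i D hD).2.2 C hi hC) (E.q_nonneg i D)
    _ = G.price v C := by rw [← Finset.sum_mul, E.q_sum, one_mul]

theorem le_reward_self (E : G.IsEquilibriumData x v q)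
    (i : Fin n) : G.δ i * v i ≤ G.reward v q i i := by
  have : ∑ C, q i C * G.price v C ≤ ∑ C, q i C * (1 - G.δ i * v i) := by
    refine Finset.sum_le_sum fun C _ => ?_
    by_cases hC : q i C = 0
    · simp [hC]
    · exact mul_le_mul_of_nonneg_left
        (by linarith [E.price_add_le i C (E.leastCost i C hC).1]) (E.q_nonneg i C)
  rw [← Finset.sum_mul, E.q_sum, one_mul] at this
  rw [reward, if_pos rfl]; linarith

theorem reward_nonneg (E : G.IsEquilibriumData x v q)
    (hδ : ∀ i, 0 < G.δ i) (j i : Fin n) : 0 ≤ G.reward v q j i := by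
  have h0 := mul_nonneg (hδ i).le (E.v_nonneg i)
  by_cases hij : j = i
  · subst hij; exact h0.trans (E.le_reward_self j)
  · rw [reward, if_neg hij]
    exact mul_nonneg (Finset.sum_nonneg fun C _ => E.q_nonneg j C) h0

/-- Any `k - 1` other supporters form a coalition that must receive at least its price, hence at
least the mean price under `q i`; the proposer keeps no more than the rest. -/
theorem le_reward_of_approved (E : G.IsEquilibriumData x v q)
    {i : Fin n} {s : Proposal n} {votes : Fin n → Bool}
    (hvotes : ∀ l, l ≠ i → votes l = true → G.δ l * v l ≤ (s : Fin n → ℝ) l) (hk : 1 ≤ G.k)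
    (happ : G.Approved i votes) : (s : Fin n → ℝ) i ≤ G.reward v q i i := by
  rw [Approved] at happ
  set L := (Finset.univ.filter fun l : Fin n => l = i ∨ votes l = true) with hL
  have hiL : i ∈ L := by simp [hL]
  have hcard : G.k - 1 ≤ (L.erase i).card := by
    rw [Finset.card_erase_of_mem hiL]; omega
  obtain ⟨C, hCL, hC⟩ := Finset.exists_subset_card_eq hcard
  have hiC : i ∉ C := fun h => Finset.notMem_erase i _ (hCL h)
  have h1 := E.mean_price i hiC (by omega)
  have h2 : G.price v C ≤ ∑ l ∈ C, (s : Fin n → ℝ) l := by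
    refine Finset.sum_le_sum fun l hl => ?_
    have hl' := Finset.mem_erase.1 (hCL hl)
    refine hvotes l hl'.1 ?_
    have := (Finset.mem_filter.1 hl'.2).2
    exact this.resolve_left hl'.1
  have h3 : ∑ l ∈ insert i C, (s : Fin n → ℝ) l ≤ ∑ l, (s : Fin n → ℝ) l :=
    Finset.sum_le_sum_of_subset_of_nonneg (Finset.subset_univ _) fun l _ _ => s.2.1 l
  have hs1 : ∑ l, (s : Fin n → ℝ) l = 1 := s.2.2
  rw [Finset.sum_insert hiC, hs1] at h3
  rw [reward, if_pos rfl]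
  linarith

theorem coalitionOffer_mem (E : G.IsEquilibriumData x v q)
    (hδ : ∀ i, 0 < G.δ i) {i : Fin n} {C : Finset (Fin n)} (hi : i ∉ C) :
    G.coalitionOffer v i C ∈ stdSimplex ℝ (Fin n) := by
  have h0 : ∀ l, 0 ≤ G.δ l * v l := fun l => mul_nonneg (hδ l).le (E.v_nonneg l)
  refine ⟨fun l => ?_, ?_⟩
  · rw [coalitionOffer]
    split_ifs
    · have := E.price_add_le i C hi
      rw [price] at this
      linarith [h0 i]
    · exact h0 l
    · exact le_rfl
  · have : ∀ l, G.coalitionOffer v i C l = (if l = i then 1 - ∑ j ∈ C, G.δ j * v j else 0) +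
        if l ∈ C then G.δ l * v l else 0 := by
      intro l
      rw [coalitionOffer]
      by_cases hl : l = i
      · subst hl; simp [hi]
      · simp [hl]
    simp_rw [this]
    rw [Finset.sum_add_distrib, Finset.sum_ite_eq' Finset.univ i, if_pos (Finset.mem_univ i),
      Finset.sum_ite_mem, Finset.univ_inter]
    ring

end IsEquilibriumData
end Deviation

open Classical in
/-- The division that buys the coalition `C`. -/
noncomputable def buy (v : Fin n → ℝ) (i : Fin n) (C : Finset (Fin n)) : Proposal n :=
  if h : G.coalitionOffer v i C ∈ stdSimplex ℝ (Fin n) then ⟨G.coalitionOffer v i C, h⟩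
  -- Arbitrary default: for equilibrium data, a coalition without the proposer always yields a point
  -- of the simplex.
  else ⟨Pi.single i 1, single_mem_stdSimplex ℝ i⟩

open Classical in
/-- The stationary strategies of the equilibrium. -/
noncomputable def equilibrium (x : Fin n → ℝ≥0) (v : Fin n → ℝ)
    (p : Fin n → PMF (Finset (Fin n))) (i : Fin n) : StationaryStrategy n where
  effort := x i
  offer := (p i).map (G.buy v i)
  vote := fun _ s => decide (G.δ i * v i ≤ (s : Fin n → ℝ) i)

section Verification
variable {G} {x : Fin n → ℝ≥0} {v : Fin n → ℝ} {q : Fin n → Finset (Fin n) → ℝ}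
  {p : Fin n → PMF (Finset (Fin n))}

theorem vote_equilibrium {i j : Fin n} {s : Proposal n} {h : History n} {y : Fin n → ℝ≥0} :
    ((G.equilibrium x v p i).toStrategy.vote h y j s = true) ↔
      G.δ i * v i ≤ (s : Fin n → ℝ) i := by
  simp [equilibrium, StationaryStrategy.toStrategy]

namespace IsEquilibriumData

theorem leastCost_of_mem_support (E : G.IsEquilibriumData x v q)
    (hp : ∀ i C, p i C = ENNReal.ofReal (q i C)) {i : Fin n} {C : Finset (Fin n)} (hC : p i C ≠ 0) :
    G.IsLeastCostCoalition v i C :=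
  E.leastCost i C fun h => hC (by rw [hp, h, ENNReal.ofReal_zero])

theorem coe_buy (E : G.IsEquilibriumData x v q) (hp : ∀ i C, p i C = ENNReal.ofReal (q i C))
    (hδ : ∀ i, 0 < G.δ i) {i : Fin n} {C : Finset (Fin n)} (hC : p i C ≠ 0) :
    (G.buy v i C : Fin n → ℝ) = G.coalitionOffer v i C := by
  rw [buy, dif_pos (E.coalitionOffer_mem hδ (E.leastCost_of_mem_support hp hC).1)]
  rfl

theorem tsum_share (E : G.IsEquilibriumData x v q) (hp : ∀ i C, p i C = ENNReal.ofReal (q i C))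
    (hδ : ∀ i, 0 < G.δ i) (j i : Fin n) :
    ∑' s, (p j).map (G.buy v j) s * shareOf i s = ENNReal.ofReal (G.reward v q j i) := by
  have hnn : ∀ C, p j C ≠ 0 → 0 ≤ G.coalitionOffer v j C i := fun C hC =>
    (E.coalitionOffer_mem hδ (E.leastCost_of_mem_support hp hC).1).1 i
  have hterm : ∀ C, p j C * shareOf i (G.buy v j C) =
      ENNReal.ofReal (q j C * G.coalitionOffer v j C i) := by
    intro C
    by_cases hC : p j C = 0
    · rw [hC, zero_mul]
      rw [hp, ENNReal.ofReal_eq_zero] at hC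
      rw [le_antisymm hC (E.q_nonneg j C), zero_mul, ENNReal.ofReal_zero]
    · rw [shareOf, E.coe_buy hp hδ hC, hp, ENNReal.ofReal_mul (E.q_nonneg j C)]
  rw [tsum_map_mul, tsum_fintype]
  simp_rw [hterm]
  rw [← ENNReal.ofReal_sum_of_nonneg]
  · congr 1
    rw [reward]
    split_ifs with hij
    · subst hij
      simp only [coalitionOffer, if_true]
      simp_rw [mul_sub, mul_one]
      rw [Finset.sum_sub_distrib, E.q_sum]
      rfl
    · rw [Finset.sum_mul, Finset.sum_filter]
      refine Finset.sum_congr rfl fun C _ => ?_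
      simp only [coalitionOffer, if_neg (Ne.symm hij)]
      split_ifs <;> simp
  · intro C _
    by_cases hC : p j C = 0
    · rw [hp, ENNReal.ofReal_eq_zero] at hC
      rw [le_antisymm hC (E.q_nonneg j C), zero_mul]
    · exact mul_nonneg (E.q_nonneg j C) (hnn C hC)

/-- A coalition offer is approved as long as the members of the coalition follow their
strategies. -/
theorem approved_buy (E : G.IsEquilibriumData x v q) (hp : ∀ i C, p i C = ENNReal.ofReal (q i C))
    (hδ : ∀ i, 0 < G.δ i) {j : Fin n} {C : Finset (Fin n)} (hC : p j C ≠ 0) {votes : Fin n → Bool}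
    (hvotes : ∀ l ∈ C, G.δ l * v l ≤ (G.buy v j C : Fin n → ℝ) l → votes l = true) :
    G.Approved j votes := by
  have hl := E.leastCost_of_mem_support hp hC
  rw [Approved, ← hl.2.1, ← Finset.card_insert_of_notMem hl.1]
  refine Finset.card_le_card fun l hlC => ?_
  rw [Finset.mem_filter]
  refine ⟨Finset.mem_univ l, ?_⟩
  rcases Finset.mem_insert.1 hlC with h | h
  · exact Or.inl h
  · refine Or.inr (hvotes l h ?_)
    rw [E.coe_buy hp hδ hC, coalitionOffer,
      if_neg (ne_of_mem_of_not_mem h hl.1), if_pos h]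

/-- A deviating proposer gets at most his equilibrium share if approved, and the smaller `δ i * v i`
if rejected. As a responder, `i` can block only offers to coalitions containing him, and these pay
him exactly `δ i * v i`. -/
theorem proposalStep_le (E : G.IsEquilibriumData x v q) (hp : ∀ i C, p i C = ENNReal.ofReal (q i C))
    (hδ : ∀ i, 0 < G.δ i) {i : Fin n} {τ : Strategy n} (hk : 1 ≤ G.k) {W W' : History n → ℝ≥0∞}
    (hW : ∀ h, W h ≤ ENNReal.ofReal (v i) + W' h) (h : History n) (y : Fin n → ℝ≥0) (j : Fin n) :
    G.proposalStep (Function.update (fun l => (G.equilibrium x v p l).toStrategy) i τ) i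
        (shareOf i) W h y j ≤ ENNReal.ofReal (G.reward v q j i) +
      G.proposalStep (Function.update (fun l => (G.equilibrium x v p l).toStrategy) i τ) i
        (fun _ => 0) W' h y j := by
  set ρ := Function.update (fun l => (G.equilibrium x v p l).toStrategy) i τ with hρ
  have hρl : ∀ l, l ≠ i → ρ l = (G.equilibrium x v p l).toStrategy := fun l hl =>
    Function.update_of_ne hl _ _
  unfold proposalStep
  by_cases hij : j = i
  · subst hij
    calc _ ≤ ∑' s, ((ρ j).offer h y s * ENNReal.ofReal (G.reward v q j j) +
          (ρ j).offer h y s * G.votingStep ρ j (fun _ => 0) W' h y j s) := by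
          refine ENNReal.tsum_le_tsum fun s => ?_
          rw [← mul_add]
          refine mul_le_mul_right (votingStep_le (hδ j).le hW (fun happ => ?_) fun _ => ?_) _
          · refine E.le_reward_of_approved (fun l hl hvl => ?_) hk happ
            rw [hρl l hl] at hvl
            exact vote_equilibrium.1 hvl
          · exact E.le_reward_self j
      _ = _ := by rw [ENNReal.tsum_add, ENNReal.tsum_mul_right, PMF.tsum_coe, one_mul]
  · have hoff : (ρ j).offer h y = (p j).map (G.buy v j) := by rw [hρl j hij]; rfl
    rw [hoff, ← E.tsum_share hp hδ j i, ← ENNReal.tsum_add]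
    refine ENNReal.tsum_le_tsum fun s => ?_
    rw [← mul_add]
    by_cases hs : (p j).map (G.buy v j) s = 0
    · simp [hs]
    obtain ⟨C, hC, rfl⟩ := (PMF.mem_support_map_iff _ _ _).1 ((PMF.mem_support_iff _ _).2 hs)
    rw [PMF.mem_support_iff] at hC
    refine mul_le_mul_right (votingStep_le (hδ i).le hW (fun _ => le_rfl) fun hrej => ?_) _
    by_cases hiC : i ∈ C
    · rw [E.coe_buy hp hδ hC, coalitionOffer, if_neg (Ne.symm hij), if_pos hiC]
    · refine absurd (E.approved_buy hp hδ hC fun l hl hle => ?_) hrej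
      rw [hρl l fun hli => hiC (hli ▸ hl)]
      exact vote_equilibrium.2 hle

theorem effortStep_le (E : G.IsEquilibriumData x v q) (hp : ∀ i C, p i C = ENNReal.ofReal (q i C))
    (hδ : ∀ i, 0 < G.δ i) {i : Fin n} {τ : Strategy n} (hk : 1 ≤ G.k)
    (hc : ∀ i (y : ℝ≥0), 0 ≤ G.c i y) (hrec : ∀ y j, 0 ≤ G.recognition y j)
    {W W' : History n → ℝ≥0∞}
    (hW : ∀ h, W h ≤ ENNReal.ofReal (v i) + W' h) (h : History n) :
    G.effortStep (Function.update (fun l => (G.equilibrium x v p l).toStrategy) i τ) i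
        (shareOf i) (fun _ => 0) W h ≤ ENNReal.ofReal (v i) +
      G.effortStep (Function.update (fun l => (G.equilibrium x v p l).toStrategy) i τ) i
        (fun _ => 0) (G.costOf i) W' h := by
  have hprop := fun y j => E.proposalStep_le (τ := τ) hp hδ hk hW h y j
  set ρ := Function.update (fun l => (G.equilibrium x v p l).toStrategy) i τ with hρ
  have hy : (fun l => (ρ l).effort h) = Function.update x i (τ.effort h) := by
    ext l
    by_cases hl : l = i
    · subst hl; simp [hρ]
    · simp [hρ, Function.update_of_ne hl, equilibrium, StationaryStrategy.toStrategy]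
  have hyi : (ρ i).effort h = τ.effort h := by simp [hρ]
  unfold effortStep
  rw [hy, hyi, zero_add]
  set y := Function.update x i (τ.effort h)
  calc _ ≤ ∑ j, (ENNReal.ofReal (G.recognition y j * G.reward v q j i) +
        ENNReal.ofReal (G.recognition y j) *
          G.proposalStep ρ i (fun _ => 0) W' h y j) := by
        refine Finset.sum_le_sum fun j _ => ?_
        rw [ENNReal.ofReal_mul (hrec y j), ← mul_add]
        exact mul_le_mul_right (hprop y j) _
    _ = ENNReal.ofReal (∑ j, G.recognition y j * G.reward v q j i) +
        ∑ j, ENNReal.ofReal (G.recognition y j) *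
          G.proposalStep ρ i (fun _ => 0) W' h y j := by
        rw [Finset.sum_add_distrib, ENNReal.ofReal_sum_of_nonneg fun j _ =>
          mul_nonneg (hrec y j) (E.reward_nonneg hδ j i)]
    -- Only here does optimality of effort enter: the expected share after a deviating effort is at
    -- most `v i` plus its cost.
    _ ≤ ENNReal.ofReal (v i) + ENNReal.ofReal (G.c i (τ.effort h)) +
        ∑ j, ENNReal.ofReal (G.recognition y j) *
          G.proposalStep ρ i (fun _ => 0) W' h y j := by
        refine add_le_add_left ?_ _
        rw [← ENNReal.ofReal_add (E.v_nonneg i) (hc i _)]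
        refine ENNReal.ofReal_le_ofReal ?_
        linarith [E.effort_opt i (τ.effort h)]
    _ = _ := by rw [add_assoc]; rfl

/-- Induction on the truncation horizon, uniformly in the history: with horizon zero both sums
vanish, and `effortStep_le` adds a period. No tail estimate is needed, since both totals are
suprema. -/
theorem gross_le (E : G.IsEquilibriumData x v q) (hp : ∀ i C, p i C = ENNReal.ofReal (q i C))
    (hδ : ∀ i, 0 < G.δ i) {i : Fin n} (τ : Strategy n) (hk : 1 ≤ G.k)
    (hc : ∀ i (y : ℝ≥0), 0 ≤ G.c i y) (hrec : ∀ y j, 0 ≤ G.recognition y j) (h : History n) :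
    G.gross (Function.update (fun l => (G.equilibrium x v p l).toStrategy) i τ) i h ≤
      ENNReal.ofReal (v i) +
        G.cost (Function.update (fun l => (G.equilibrium x v p l).toStrategy) i τ) i h := by
  have key : ∀ T h, (G.effortStep (Function.update (fun l =>
        (G.equilibrium x v p l).toStrategy) i τ) i (shareOf i) fun _ => 0)^[T] (fun _ => 0) h ≤
      ENNReal.ofReal (v i) + (G.effortStep (Function.update (fun l =>
        (G.equilibrium x v p l).toStrategy) i τ) i (fun _ => 0) (G.costOf i))^[T]
          (fun _ => 0) h := by
    intro T
    induction T with
    | zero => intro h; exact zero_le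
    | succ T ih =>
      intro h
      rw [Function.iterate_succ_apply', Function.iterate_succ_apply']
      exact E.effortStep_le hp hδ hk hc hrec ih h
  refine iSup_le fun T => (key T h).trans (add_le_add_right ?_ _)
  exact le_iSup (fun T => (G.effortStep (Function.update (fun l =>
    (G.equilibrium x v p l).toStrategy) i τ) i (fun _ => 0) (G.costOf i))^[T] (fun _ => 0) h) T

theorem proposalStep_equilibrium (E : G.IsEquilibriumData x v q)
    (hp : ∀ i C, p i C = ENNReal.ofReal (q i C)) (hδ : ∀ i, 0 < G.δ i)
    (i : Fin n) (share : Proposal n → ℝ≥0∞)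
    (W : History n → ℝ≥0∞) (h : History n) (y : Fin n → ℝ≥0) (j : Fin n) :
    G.proposalStep (fun l => (G.equilibrium x v p l).toStrategy) i share W h y j =
      ∑' s, (p j).map (G.buy v j) s * share s := by
  refine tsum_congr fun s => ?_
  change (p j).map (G.buy v j) s * _ = _
  by_cases hs : (p j).map (G.buy v j) s = 0
  · simp [hs]
  obtain ⟨C, hC, rfl⟩ := (PMF.mem_support_map_iff _ _ _).1 ((PMF.mem_support_iff _ _).2 hs)
  rw [PMF.mem_support_iff] at hC
  rw [votingStep, if_pos]
  exact E.approved_buy hp hδ hC fun l _ hle => vote_equilibrium.2 hle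

theorem gross_equilibrium (E : G.IsEquilibriumData x v q)
    (hp : ∀ i C, p i C = ENNReal.ofReal (q i C)) (hδ : ∀ i, 0 < G.δ i)
    (hrec : ∀ y j, 0 ≤ G.recognition y j) (i : Fin n) (h : History n) :
    G.gross (fun l => (G.equilibrium x v p l).toStrategy) i h =
      ENNReal.ofReal (∑ j, G.recognition x j * G.reward v q j i) := by
  refine G.total_eq_of_iterate_succ fun W => ?_
  rw [effortStep, zero_add, ENNReal.ofReal_sum_of_nonneg fun j _ =>
    mul_nonneg (hrec x j) (E.reward_nonneg hδ j i)]
  refine Finset.sum_congr rfl fun j _ => ?_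
  rw [E.proposalStep_equilibrium hp hδ, E.tsum_share hp hδ, ENNReal.ofReal_mul (hrec x j)]
  rfl

theorem cost_equilibrium (E : G.IsEquilibriumData x v q)
    (hp : ∀ i C, p i C = ENNReal.ofReal (q i C)) (hδ : ∀ i, 0 < G.δ i) (i : Fin n) (h : History n) :
    G.cost (fun l => (G.equilibrium x v p l).toStrategy) i h = ENNReal.ofReal (G.c i (x i)) := by
  refine G.total_eq_of_iterate_succ fun W => ?_
  rw [effortStep]
  simp_rw [E.proposalStep_equilibrium hp hδ]
  simp
  rfl

theorem payoff_equilibrium (E : G.IsEquilibriumData x v q)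
    (hp : ∀ i C, p i C = ENNReal.ofReal (q i C)) (hδ : ∀ i, 0 < G.δ i)
    (hc : ∀ i (y : ℝ≥0), 0 ≤ G.c i y)
    (hrec : ∀ y j, 0 ≤ G.recognition y j) (i : Fin n) (h : History n) :
    G.payoff (fun l => (G.equilibrium x v p l).toStrategy) i h = (v i : EReal) := by
  rw [payoff, E.gross_equilibrium hp hδ hrec, E.cost_equilibrium hp hδ, coe_ofReal_sub_ofReal
    (Finset.sum_nonneg fun j _ => mul_nonneg (hrec x j) (E.reward_nonneg hδ j i)) (hc i _),
    E.value_eq]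

open Classical in
theorem payoffVoting_equilibrium (E : G.IsEquilibriumData x v q)
    (hp : ∀ i C, p i C = ENNReal.ofReal (q i C)) (hδ : ∀ i, 0 < G.δ i)
    (hc : ∀ i (y : ℝ≥0), 0 ≤ G.c i y)
    (hrec : ∀ y j, 0 ≤ G.recognition y j) (i : Fin n) (h : History n) (y : Fin n → ℝ≥0)
    (j : Fin n) (s : Proposal n) :
    G.payoffVoting (fun l => (G.equilibrium x v p l).toStrategy) i h y j s =
      ((if G.Approved j (fun l => (G.equilibrium x v p l).toStrategy.vote h y j s)
        then (s : Fin n → ℝ) i else G.δ i * v i : ℝ) : EReal) := by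
  have hU := Finset.sum_nonneg (s := Finset.univ) fun j _ =>
    mul_nonneg (hrec x j) (E.reward_nonneg hδ j i)
  rw [payoffVoting, votingStep, votingStep]
  split_ifs
  · simpa only [shareOf, ENNReal.ofReal_zero, sub_zero] using
      coe_ofReal_sub_ofReal (a := (s : Fin n → ℝ) i) (s.2.1 i) le_rfl
  · rw [E.gross_equilibrium hp hδ hrec, E.cost_equilibrium hp hδ, ← ENNReal.ofReal_mul (hδ i).le,
      ← ENNReal.ofReal_mul (hδ i).le, coe_ofReal_sub_ofReal (mul_nonneg (hδ i).le hU)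
      (mul_nonneg (hδ i).le (hc i _)), ← mul_sub, E.value_eq]

theorem isSSPE_equilibrium (E : G.IsEquilibriumData x v q)
    (hp : ∀ i C, p i C = ENNReal.ofReal (q i C)) (hδ : ∀ i, 0 < G.δ i)
    (hk : 1 ≤ G.k) (hc : ∀ i (y : ℝ≥0), 0 ≤ G.c i y)
    (hrec : ∀ y j, 0 ≤ G.recognition y j) : G.IsSSPE (G.equilibrium x v p) := by
  intro i τ h _
  have hW := E.gross_le (i := i) hp hδ τ hk hc hrec
  refine ⟨?_, fun y j => ?_, fun y j s => ?_⟩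
  · rw [E.payoff_equilibrium hp hδ hc hrec]
    exact coe_sub_coe_le (E.v_nonneg i) (hW h)
  · have h1 : G.payoffProposal (fun l => (G.equilibrium x v p l).toStrategy) i h y j =
        (G.reward v q j i : EReal) := by
      rw [payoffProposal, E.proposalStep_equilibrium hp hδ, E.proposalStep_equilibrium hp hδ,
        E.tsum_share hp hδ]
      have := coe_ofReal_sub_ofReal (E.reward_nonneg hδ j i) le_rfl
      simpa using this
    rw [h1]
    exact coe_sub_coe_le (E.reward_nonneg hδ j i) (E.proposalStep_le hp hδ hk hW h y j)
  · rw [E.payoffVoting_equilibrium hp hδ hc hrec]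
    set ρ := Function.update (fun l => (G.equilibrium x v p l).toStrategy) i τ with hρ
    have hρl : ∀ l, l ≠ i → ρ l = (G.equilibrium x v p l).toStrategy := fun l hl =>
      Function.update_of_ne hl _ _
    have h0 := mul_nonneg (hδ i).le (E.v_nonneg i)
    refine coe_sub_coe_le (by split_ifs; exacts [s.2.1 i, h0])
      -- A unilateral vote changes the outcome only in the direction of the change. Approval caused
      -- by deviating means that `i` had planned to reject, so his share is below `δ i * v i`;
      -- symmetrically for a rejection caused by deviating.
      (votingStep_le (hδ i).le hW (fun happ => ?_) fun hrej => ?_)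
    · split_ifs with hA
      · exact le_rfl
      · by_contra! hlt
        refine hA (happ.trans (Finset.card_le_card fun l hl => ?_))
        rw [Finset.mem_filter] at hl ⊢
        refine ⟨hl.1, hl.2.imp_right fun hvl => ?_⟩
        by_cases hli : l = i
        · subst hli; exact vote_equilibrium.2 hlt.le
        · simpa only [hρl l hli] using hvl
    · split_ifs with hA
      · by_contra! hlt
        refine hrej (hA.trans (Finset.card_le_card fun l hl => ?_))
        rw [Finset.mem_filter] at hl ⊢
        refine ⟨hl.1, hl.2.imp_right fun hvl => ?_⟩
        by_cases hli : l = i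
        · subst hli; exact absurd (vote_equilibrium.1 hvl) hlt.not_ge
        · simpa only [hρl l hli] using hvl
      · exact le_rfl

end IsEquilibriumData
end Verification
end Game
end Bargaining

end

/-! ### Uniqueness of equilibrium in the contest for a prize of one -/

section
open Set Filter Topology
open scoped NNReal ENNReal
namespace Bargaining
namespace Game
variable {n : ℕ} (G : Game n)

/-- A Nash equilibrium of the contest for a prize of one. -/
def IsContestEquilibrium (x : Fin n → ℝ≥0) : Prop :=
  ∀ i (y : ℝ≥0), G.recognition (Function.update x i y) i - G.c i y ≤
    G.recognition x i - G.c i (x i)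

section Contest
variable {G}

theorem impact_nonneg (hα : ∀ i, 0 ≤ G.α i) (hβ : ∀ i, 0 ≤ G.β i) (hf : ∀ i, IsTechnology (G.f i))
    (i : Fin n) (y : ℝ≥0) : 0 ≤ G.impact i y :=
  add_nonneg (mul_nonneg (hα i) ((hf i).nonneg y.coe_nonneg)) (hβ i)

theorem recognition_nonneg (hα : ∀ i, 0 ≤ G.α i) (hβ : ∀ i, 0 ≤ G.β i)
    (hf : ∀ i, IsTechnology (G.f i)) (x : Fin n → ℝ≥0) (i : Fin n) : 0 ≤ G.recognition x i := by
  rw [recognition]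
  split_ifs with h
  · exact div_nonneg (impact_nonneg hα hβ hf i _) h.le
  · positivity

theorem sum_impact_update (x : Fin n → ℝ≥0) (i : Fin n) (y : ℝ≥0) :
    ∑ j, G.impact j (Function.update x i y j) =
      ∑ j, G.impact j (x j) - G.impact i (x i) + G.impact i y := by
  rw [← Finset.sum_erase_eq_sub (Finset.mem_univ i), ← Finset.add_sum_erase _ _ (Finset.mem_univ i),
    Function.update_self, add_comm]
  congr 1
  exact Finset.sum_congr rfl fun j hj => by rw [Function.update_of_ne (Finset.ne_of_mem_erase hj)]

/-- The first-order conditions of a contest equilibrium. -/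
theorem IsContestEquilibrium.first_order (hf : ∀ i, IsTechnology (G.f i))
    {x : Fin n → ℝ≥0} (hx : G.IsContestEquilibrium x)
    (hS : 0 < ∑ j, G.impact j (x j)) {i : Fin n} {r : ℝ → ℝ}
    (hr : IsMarginalCost (G.f i) (G.c i) r) :
    G.α i * (∑ j, G.impact j (x j) - G.impact i (x i)) ≤ (∑ j, G.impact j (x j)) ^ 2 * r (x i) ∧
    (0 < x i → (∑ j, G.impact j (x j)) ^ 2 * r (x i) ≤
      G.α i * (∑ j, G.impact j (x j) - G.impact i (x i))) := by
  set S := ∑ j, G.impact j (x j) with hSdef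
  set Q := S - G.impact i (x i) with hQ
  let T : ℝ → ℝ := fun y => Q + (G.α i * G.f i y + G.β i)
  have hTx : T (x i) = S := by simp only [T, hQ, impact]; ring
  -- With rivals' impact and own headstart held fixed, the change in winning probability is `Q * α *
  -- (f y - f x) / (T y * S)`; the no-deviation inequality is multiplied out.
  have hdev : ∀ y : ℝ, 0 ≤ y → 0 < T y →
      Q * (G.α i * (G.f i y - G.f i (x i))) ≤ (G.c i y - G.c i (x i)) * (T y * S) := by
    intro y hy hTy
    lift y to ℝ≥0 using hy
    have hsum : ∑ j, G.impact j (Function.update x i y j) = T y := by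
      rw [sum_impact_update]; rfl
    have h1 := hx i y
    rw [recognition, recognition, hsum, ← hSdef, if_pos hTy, if_pos hS, Function.update_self] at h1
    have h2 : G.impact i y / T y - G.impact i (x i) / S =
        Q * (G.α i * (G.f i y - G.f i (x i))) / (T y * S) := by
      rw [div_sub_div _ _ hTy.ne' hS.ne']
      congr 1
      simp only [T, hQ, impact]
      ring
    have h3 : Q * (G.α i * (G.f i y - G.f i (x i))) / (T y * S) ≤ G.c i y - G.c i (x i) := by
      rw [← h2]
      linarith
    rwa [div_le_iff₀ (mul_pos hTy hS)] at h3
  have hTcont : ContinuousWithinAt T (Ici 0) (x i) :=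
    continuousWithinAt_const.add ((continuousWithinAt_const.mul ((hf i).1 _ (x i).coe_nonneg)).add
      continuousWithinAt_const)
  have hlim : Tendsto (fun y => T y * S * r y) (𝓝[Ici 0] (x i : ℝ)) (𝓝 (S ^ 2 * r (x i))) := by
    have := (hTcont.tendsto.mul_const S).mul (hr.continuousOn _ (x i).coe_nonneg).tendsto
    rwa [hTx, ← sq] at this
  have hTpos : ∀ᶠ y in 𝓝[Ici 0] (x i : ℝ), 0 < T y :=
    hTcont.eventually (lt_mem_nhds (by rw [hTx]; exact hS))
  constructor
  · have hle : 𝓝[>] (x i : ℝ) ≤ 𝓝[Ici 0] (x i : ℝ) :=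
      nhdsWithin_mono _ fun y hy => (x i).coe_nonneg.trans (le_of_lt hy)
    -- The cost increment is at most `r y * (f y - f x)`. Dividing by `f y - f x` and letting `y`
    -- decrease to `x i` gives the condition without differentiating at zero effort.
    refine ge_of_tendsto (hlim.mono_left hle) ?_
    filter_upwards [hTpos.filter_mono hle, self_mem_nhdsWithin] with y hTy hy
    have hy' : (x i : ℝ) < y := hy
    have hy0 : 0 ≤ y := (x i).coe_nonneg.trans hy'.le
    have hfy : 0 < G.f i y - G.f i (x i) :=
      sub_pos.2 ((hf i).strictMonoOn (mem_Ici.2 (x i).coe_nonneg) (mem_Ici.2 hy0) hy')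
    have h1 := hdev y hy0 hTy
    have h2 := hr.mul_sub_le y (x i) hy0 (x i).coe_nonneg
    have h3 := mul_le_mul_of_nonneg_right (show G.c i y - G.c i (x i) ≤
      r y * (G.f i y - G.f i (x i)) by linarith) (mul_pos hTy hS).le
    refine le_of_mul_le_mul_right ?_ hfy
    linarith
  · intro hxi
    have hxi' : (0 : ℝ) < x i := hxi
    have hle : 𝓝[Ioo 0 (x i : ℝ)] (x i : ℝ) ≤ 𝓝[Ici 0] (x i : ℝ) :=
      nhdsWithin_mono _ fun y hy => hy.1.le
    have : (𝓝[Ioo 0 (x i : ℝ)] (x i : ℝ)).NeBot := by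
      rw [nhdsWithin_Ioo_eq_nhdsLT hxi']; infer_instance
    refine le_of_tendsto (hlim.mono_left hle) ?_
    filter_upwards [hTpos.filter_mono hle, self_mem_nhdsWithin] with y hTy hy
    have hfy : 0 < G.f i (x i) - G.f i y :=
      sub_pos.2 ((hf i).strictMonoOn (mem_Ici.2 hy.1.le) (mem_Ici.2 (x i).coe_nonneg) hy.2)
    have h1 := hdev y hy.1.le hTy
    have h2 := hr.mul_sub_le y (x i) hy.1.le (x i).coe_nonneg
    have h3 := mul_le_mul_of_nonneg_right h2 (mul_pos hTy hS).le
    refine le_of_mul_le_mul_right ?_ hfy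
    linarith

/-- At zero total impact a competitor wins with probability `1 / n ≤ 1 / 2`, but an effort costing
less than `1 / 2` would make him win for sure. -/
theorem IsContestEquilibrium.sum_impact_pos (hα : ∀ i, 0 ≤ G.α i) (hβ : ∀ i, 0 ≤ G.β i)
    (hf : ∀ i, IsTechnology (G.f i)) (hc : ∀ i, IsEffortCost (G.c i))
    {x : Fin n → ℝ≥0} (hx : G.IsContestEquilibrium x)
    (hn : 2 ≤ n) (hnd : 0 < ∑ i, G.β i ∨ ∃ a b, a ≠ b ∧ 0 < G.α a ∧ 0 < G.α b) :
    0 < ∑ j, G.impact j (x j) := by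
  have hnn := fun j => impact_nonneg hα hβ hf j (x j)
  rcases hnd with h | ⟨a, -, -, ha, -⟩
  · refine h.trans_le (Finset.sum_le_sum fun i _ => ?_)
    exact le_add_of_nonneg_left (mul_nonneg (hα i) ((hf i).nonneg (x i).coe_nonneg))
  refine lt_of_le_of_ne (Finset.sum_nonneg fun j _ => hnn j) fun h0 => ?_
  have himp : G.impact a (x a) = 0 :=
    (Finset.sum_eq_zero_iff_of_nonneg fun j _ => hnn j).1 h0.symm a (Finset.mem_univ a)
  have hβa : G.β a = 0 := by
    have := mul_nonneg (hα a) ((hf a).nonneg (x a).coe_nonneg)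
    rw [impact] at himp
    linarith [hβ a]
  have hcont : Tendsto (G.c a) (𝓝[>] 0) (𝓝 0) := by
    have := ((hc a).1 0 (mem_Ici.2 le_rfl)).tendsto.mono_left
      (nhdsWithin_mono _ Ioi_subset_Ici_self)
    rwa [(hc a).2.1] at this
  obtain ⟨y, hy, hy0⟩ := ((hcont.eventually (gt_mem_nhds (show (0 : ℝ) < 1 / 2 by norm_num))).and
    self_mem_nhdsWithin).exists
  lift y to ℝ≥0 using le_of_lt hy0
  have hy0 : 0 < (y : ℝ) := hy0
  have hdev := hx a y
  have hpos : 0 < G.impact a y := by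
    rw [impact, hβa, add_zero]; exact mul_pos ha ((hf a).pos hy0)
  have h1 : G.recognition (Function.update x a y) a = 1 := by
    rw [recognition, sum_impact_update, Function.update_self, ← h0, himp, sub_zero, zero_add,
      if_pos hpos, div_self hpos.ne']
  have h2 : G.recognition x a = 1 / n := by
    rw [recognition, ← h0, if_neg (lt_irrefl 0)]
  have h3 : (1 : ℝ) / n ≤ 1 / 2 := by
    apply one_div_le_one_div_of_le (by norm_num)
    exact_mod_cast hn
  rw [h1, h2] at hdev
  linarith [(hc a).nonneg (x a).coe_nonneg]

/-- The marginal condition reads `α i * (1 - p i) ≤ S * r i (x i)`, with equality at positive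
effort. A larger total makes marginal output more expensive relative to its return, so no agent's
winning probability can rise; as probabilities sum to one, none changes. -/
theorem IsContestEquilibrium.eq_of_sum_le (hα : ∀ i, 0 ≤ G.α i) (hβ : ∀ i, 0 ≤ G.β i)
    (hf : ∀ i, IsTechnology (G.f i)) (hc : ∀ i, IsEffortCost (G.c i))
    {x x' : Fin n → ℝ≥0} (hx : G.IsContestEquilibrium x)
    (hx' : G.IsContestEquilibrium x') (hS : 0 < ∑ j, G.impact j (x j))
    (hSS : ∑ j, G.impact j (x j) ≤ ∑ j, G.impact j (x' j)) : x = x' := by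
  choose r hr using fun i => exists_isMarginalCost (hf i) (hc i)
  have hS' := hS.trans_le hSS
  have h1 := fun i => hx.first_order hf hS (hr i)
  have h2 := fun i => hx'.first_order hf hS' (hr i)
  set S := ∑ j, G.impact j (x j) with hSdef
  set S' := ∑ j, G.impact j (x' j) with hSdef'
  have hsum : ∑ i, G.impact i (x i) / S = 1 := by
    rw [← Finset.sum_div, ← hSdef, div_self hS.ne']
  have hsum' : ∑ i, G.impact i (x' i) / S' = 1 := by
    rw [← Finset.sum_div, ← hSdef', div_self hS'.ne']
  have hlt : ∀ i, G.impact i (x i) < G.impact i (x' i) → (x i : ℝ) < x' i := by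
    intro i hi
    by_contra! hle
    have := (hf i).strictMonoOn.monotoneOn (mem_Ici.2 (x' i).coe_nonneg)
      (mem_Ici.2 (x i).coe_nonneg) hle
    have := mul_le_mul_of_nonneg_left this (hα i)
    simp only [impact] at hi
    linarith
  have hfo : ∀ i, G.α i * (1 - G.impact i (x i) / S) ≤ S * r i (x i) := by
    intro i
    have := (h1 i).1
    refine le_of_mul_le_mul_right ?_ hS
    calc _ = G.α i * (S - G.impact i (x i)) := by field_simp
      _ ≤ _ := this
      _ = _ := by ring
  have hfo' : ∀ i, (x i : ℝ) < x' i →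
      S' * r i (x' i) ≤ G.α i * (1 - G.impact i (x' i) / S') := by
    intro i hi
    have := (h2 i).2 (NNReal.coe_pos.1 ((x i).coe_nonneg.trans_lt hi))
    refine le_of_mul_le_mul_right ?_ hS'
    calc _ = S' ^ 2 * r i (x' i) := by ring
      _ ≤ _ := this
      _ = _ := by field_simp
  have hr_le : ∀ i, (x i : ℝ) < x' i → r i (x i) ≤ r i (x' i) := fun i hi =>
    (hr i).monotoneOn (mem_Ici.2 (x i).coe_nonneg) (mem_Ici.2 (x' i).coe_nonneg) hi.le
  have hα_pos : ∀ i, G.impact i (x i) < G.impact i (x' i) → 0 < G.α i := by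
    intro i hi
    refine lt_of_le_of_ne (hα i) fun h0 => ?_
    simp [impact, ← h0] at hi
  have hp_le : ∀ i, G.impact i (x' i) / S' ≤ G.impact i (x i) / S := by
    intro i
    by_contra! hi
    have hF : G.impact i (x i) < G.impact i (x' i) := by
      rw [div_lt_div_iff₀ hS hS'] at hi
      have h3 := mul_le_mul_of_nonneg_left hSS (impact_nonneg hα hβ hf i (x i))
      exact lt_of_mul_lt_mul_right (h3.trans_lt hi) hS.le
    have h4 := hlt i hF
    have h5 : S * r i (x i) ≤ S' * r i (x' i) :=
      mul_le_mul hSS (hr_le i h4) ((hr i).nonneg _ (x i).coe_nonneg) hS'.le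
    have h6 := (hfo i).trans (h5.trans (hfo' i h4))
    have := le_of_mul_le_mul_left h6 (hα_pos i hF)
    linarith
  have hp : ∀ i, G.impact i (x' i) / S' = G.impact i (x i) / S := fun i =>
    (Finset.sum_eq_sum_iff_of_le fun i _ => hp_le i).1 (hsum'.trans hsum.symm) i
      (Finset.mem_univ i)
  -- If the total strictly rose at equal probabilities, an agent with positive impact would raise
  -- his effort. His marginal cost term would strictly increase while his return stayed the same.
  have hSeq : S = S' := by
    refine le_antisymm hSS (not_lt.1 fun hlt' => ?_)
    obtain ⟨i, -, hi⟩ : ∃ i ∈ Finset.univ, 0 < G.impact i (x i) :=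
      Finset.exists_lt_of_sum_lt (by simpa using hS)
    have hF : G.impact i (x i) < G.impact i (x' i) := by
      have h3 := hp i
      rw [div_eq_div_iff hS'.ne' hS.ne'] at h3
      have h4 := mul_lt_mul_of_pos_left hlt' hi
      exact lt_of_mul_lt_mul_right (h4.trans_eq h3.symm) hS.le
    have h4 := hlt i hF
    have h5 : S * r i (x i) < S' * r i (x' i) :=
      (mul_le_mul_of_nonneg_left (hr_le i h4) hS.le).trans_lt
        (mul_lt_mul_of_pos_right hlt' ((hr i).pos _ ((x i).coe_nonneg.trans_lt h4)))
    have h6 := (hfo i).trans_lt (h5.trans_le (hfo' i h4))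
    rw [hp i] at h6
    exact lt_irrefl _ h6
  have hF : ∀ i, G.impact i (x' i) = G.impact i (x i) := fun i => by
    have := hp i
    rwa [← hSeq, div_left_inj' hS.ne'] at this
  funext i
  -- If `α i = 0`, impact does not determine effort, but the first-order condition forces zero
  -- effort; otherwise `f i` is injective.
  rcases (hα i).eq_or_lt with h0 | h0
  · have hz : x i = 0 := by
      by_contra hne
      have := (h1 i).2 (pos_iff_ne_zero.2 hne)
      rw [← h0, zero_mul] at this
      have hpos := (hr i).pos _ (NNReal.coe_pos.2 (pos_iff_ne_zero.2 hne))
      nlinarith [mul_pos (pow_pos hS 2) hpos]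
    have hz' : x' i = 0 := by
      by_contra hne
      have := (h2 i).2 (pos_iff_ne_zero.2 hne)
      rw [← h0, zero_mul] at this
      have hpos := (hr i).pos _ (NNReal.coe_pos.2 (pos_iff_ne_zero.2 hne))
      nlinarith [mul_pos (pow_pos hS' 2) hpos]
    rw [hz, hz']
  · have := hF i
    simp only [impact, add_left_inj] at this
    have := mul_left_cancel₀ h0.ne' this
    exact (NNReal.coe_injective ((hf i).strictMonoOn.injOn (mem_Ici.2 (x' i).coe_nonneg)
      (mem_Ici.2 (x i).coe_nonneg) this)).symm

theorem IsContestEquilibrium.eq (hα : ∀ i, 0 ≤ G.α i) (hβ : ∀ i, 0 ≤ G.β i)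
    (hf : ∀ i, IsTechnology (G.f i)) (hc : ∀ i, IsEffortCost (G.c i)) (hn : 2 ≤ n)
    (hnd : 0 < ∑ i, G.β i ∨ ∃ a b, a ≠ b ∧ 0 < G.α a ∧ 0 < G.α b) {x x' : Fin n → ℝ≥0}
    (hx : G.IsContestEquilibrium x) (hx' : G.IsContestEquilibrium x') : x = x' := by
  have hS := hx.sum_impact_pos hα hβ hf hc hn hnd
  have hS' := hx'.sum_impact_pos hα hβ hf hc hn hnd
  rcases le_total (∑ j, G.impact j (x j)) (∑ j, G.impact j (x' j)) with h | h
  · exact hx.eq_of_sum_le hα hβ hf hc hx' hS h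
  · exact (hx'.eq_of_sum_le hα hβ hf hc hx hS' h).symm

end Contest
end Game
end Bargaining

end

/-! ### The dictatorial rule -/

section
open Set Filter Topology
open scoped NNReal ENNReal
namespace Bargaining

/-- The division that gives everything to agent `i`. -/
noncomputable def keepAll {n : ℕ} (i : Fin n) : Proposal n :=
  ⟨Pi.single i 1, single_mem_stdSimplex ℝ i⟩

theorem eq_keepAll {n : ℕ} {i : Fin n} {s : Proposal n} (h : 1 ≤ (s : Fin n → ℝ) i) :
    s = keepAll i := by
  have hs1 : ∑ l, (s : Fin n → ℝ) l = 1 := s.2.2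
  have hs0 : ∀ l, 0 ≤ (s : Fin n → ℝ) l := s.2.1
  rw [← Finset.add_sum_erase _ _ (Finset.mem_univ i)] at hs1
  have hzero : ∑ l ∈ Finset.univ.erase i, (s : Fin n → ℝ) l = 0 :=
    le_antisymm (by linarith) (Finset.sum_nonneg fun l _ => hs0 l)
  refine Subtype.ext (funext fun l => ?_)
  by_cases hl : l = i
  · subst hl
    change (s : Fin n → ℝ) l = (Pi.single l 1 : Fin n → ℝ) l
    rw [Pi.single_eq_same]; linarith
  · change (s : Fin n → ℝ) l = (Pi.single i 1 : Fin n → ℝ) l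
    rw [Pi.single_eq_of_ne hl]
    exact (Finset.sum_eq_zero_iff_of_nonneg fun l _ => hs0 l).1 hzero l
      (Finset.mem_erase.2 ⟨hl, Finset.mem_univ l⟩)

theorem shareOf_keepAll {n : ℕ} (i j : Fin n) :
    Game.shareOf i (keepAll j) = if j = i then 1 else 0 := by
  change ENNReal.ofReal ((Pi.single j 1 : Fin n → ℝ) i) = _
  by_cases h : j = i
  · subst h; simp
  · rw [Pi.single_eq_of_ne (Ne.symm h)]; simp [h]

theorem shareOf_le_one {n : ℕ} (i : Fin n) (s : Proposal n) : Game.shareOf i s ≤ 1 := by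
  have hs1 : ∑ l, (s : Fin n → ℝ) l = 1 := s.2.2
  have hs0 : ∀ l, 0 ≤ (s : Fin n → ℝ) l := s.2.1
  rw [Game.shareOf, ENNReal.ofReal_le_one, ← hs1]
  exact Finset.single_le_sum (fun l _ => hs0 l) (Finset.mem_univ i)

theorem tsum_pure_mul {A : Type*} (a : A) (w : A → ℝ≥0∞) : ∑' b, PMF.pure a b * w b = w a := by
  classical
  rw [tsum_eq_single a]
  · simp
  · intro b hb; simp [hb]

/-- An offer that yields its proposer everything in expectation does so with certainty. -/
theorem offer_eq_pure {n : ℕ} {i : Fin n} {o : PMF (Proposal n)}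
    (h : 1 ≤ ∑' s, o s * Game.shareOf i s) : o = PMF.pure (keepAll i) := by
  have hsupp : ∀ s, o s ≠ 0 → s = keepAll i := by
    intro s hs
    refine eq_keepAll ?_
    by_contra! hlt
    have hterm : ∀ t, o t * Game.shareOf i t ≤ o t := fun t =>
      mul_le_of_le_one_right' (shareOf_le_one i t)
    have hfin : ∑' t, o t * Game.shareOf i t ≠ ∞ :=
      ne_top_of_le_ne_top (by rw [o.tsum_coe]; exact ENNReal.one_ne_top)
        (ENNReal.tsum_le_tsum hterm)
    -- An outcome of positive probability that gives the proposer less than one strictly lowers the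
    -- expectation; the comparison is legitimate because the sum is finite.
    have hstrict : o s * Game.shareOf i s < o s := by
      have h1 : Game.shareOf i s < 1 := by
        rw [Game.shareOf, ENNReal.ofReal_lt_one]; exact hlt
      calc o s * Game.shareOf i s < o s * 1 :=
            ENNReal.mul_lt_mul_right hs (o.apply_ne_top s) h1
        _ = o s := mul_one _
    have := ENNReal.tsum_lt_tsum hfin hterm hstrict
    rw [o.tsum_coe] at this
    exact absurd h this.not_ge
  have hsup : o.support = {keepAll i} :=
    o.support_nonempty.subset_singleton_iff.1 fun s hs => hsupp s hs
  refine PMF.ext fun s => ?_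
  by_cases hs : s = keepAll i
  · subst hs
    rw [(PMF.apply_eq_one_iff o _).2 hsup, PMF.pure_apply_self]
  · rw [PMF.pure_apply_of_ne _ _ hs]
    by_contra hne
    exact hs (hsupp s hne)

namespace Game
variable {n : ℕ} {G : Game n}

section Dictatorial

theorem approved_of_k_eq_one (hk : G.k = 1)
    (j : Fin n) (votes : Fin n → Bool) : G.Approved j votes := by
  rw [Approved, hk, Nat.one_le_iff_ne_zero, Finset.card_ne_zero]
  exact ⟨j, by simp⟩

theorem proposalStep_of_k_eq_one (hk : G.k = 1)
    (ρ : Profile n) (i : Fin n) (share : Proposal n → ℝ≥0∞)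
    (W : History n → ℝ≥0∞) (h : History n) (y : Fin n → ℝ≥0) (j : Fin n) :
    G.proposalStep ρ i share W h y j = ∑' s, (ρ j).offer h y s * share s :=
  tsum_congr fun s => by rw [votingStep, if_pos (G.approved_of_k_eq_one hk j _)]

theorem payoffProposal_of_k_eq_one (hk : G.k = 1) (ρ : Profile n) (i : Fin n) (h : History n)
    (y : Fin n → ℝ≥0) (j : Fin n) :
    G.payoffProposal ρ i h y j = ((∑' s, (ρ j).offer h y s * shareOf i s : ℝ≥0∞) : EReal) := by
  rw [payoffProposal, proposalStep_of_k_eq_one hk, proposalStep_of_k_eq_one hk]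
  simp

/-- The proposer's own vote suffices, so proposing to keep everything secures one. Optimality in the
proposal subgame requires the same of the equilibrium offer. -/
theorem IsSSPE.offer_eq (hk : G.k = 1)
    {τ : Fin n → StationaryStrategy n} (hτ : G.IsSSPE τ) (i : Fin n) :
    (τ i).offer = PMF.pure (keepAll i) := by
  let d : Strategy n := { (τ i).toStrategy with offer := fun _ _ => PMF.pure (keepAll i) }
  have h := (hτ i d [] (by simp [IsHistory])).2.1 (fun _ => 0) i
  rw [payoffProposal_of_k_eq_one hk, payoffProposal_of_k_eq_one hk, Function.update_self,
    EReal.coe_ennreal_le_coe_ennreal_iff] at h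
  refine offer_eq_pure ?_
  have h1 : ∑' s, d.offer [] (fun _ => 0) s * shareOf i s = 1 := by
    change ∑' s, PMF.pure (keepAll i) s * shareOf i s = 1
    rw [tsum_pure_mul, shareOf_keepAll, if_pos rfl]
  rw [h1] at h
  exact h

theorem payoff_of_keepAll (hk : G.k = 1)
    {ρ : Profile n} (hρ : ∀ j h y, (ρ j).offer h y = PMF.pure (keepAll j))
    (hc : ∀ i (y : ℝ≥0), 0 ≤ G.c i y) (hrec : ∀ y j, 0 ≤ G.recognition y j)
    (i : Fin n) (h : History n) :
    G.payoff ρ i h = ((G.recognition (fun l => (ρ l).effort h) i -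
      G.c i ((ρ i).effort h) : ℝ) : EReal) := by
  have hg : G.gross ρ i h = ENNReal.ofReal (G.recognition (fun l => (ρ l).effort h) i) := by
    refine G.total_eq_of_iterate_succ fun W => ?_
    rw [effortStep, zero_add]
    simp_rw [proposalStep_of_k_eq_one hk, hρ, tsum_pure_mul, shareOf_keepAll]
    simp
  have hcost : G.cost ρ i h = ENNReal.ofReal (G.c i ((ρ i).effort h)) := by
    refine G.total_eq_of_iterate_succ fun W => ?_
    rw [effortStep]
    simp_rw [proposalStep_of_k_eq_one hk]
    simp [costOf]
  rw [payoff, hg, hcost, coe_ofReal_sub_ofReal (hrec _ i) (hc i _)]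

theorem IsSSPE.payoff_eq (hk : G.k = 1) {τ : Fin n → StationaryStrategy n} (hτ : G.IsSSPE τ)
    (hc : ∀ i (y : ℝ≥0), 0 ≤ G.c i y) (hrec : ∀ y j, 0 ≤ G.recognition y j) (i : Fin n) :
    G.stationaryPayoff τ i = ((G.recognition (fun l => (τ l).effort) i -
      G.c i (τ i).effort : ℝ) : EReal) :=
  payoff_of_keepAll hk (fun j _ _ => hτ.offer_eq hk j) hc hrec i []

/-- Every first-period proposal passes and gives all to its author, so switching to effort `y`
changes the payoff exactly as in the contest. -/
theorem IsSSPE.isContestEquilibrium (hk : G.k = 1)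
    {τ : Fin n → StationaryStrategy n} (hτ : G.IsSSPE τ)
    (hc : ∀ i (y : ℝ≥0), 0 ≤ G.c i y) (hrec : ∀ y j, 0 ≤ G.recognition y j) :
    G.IsContestEquilibrium fun l => (τ l).effort := by
  intro i y
  let d : Strategy n := { (τ i).toStrategy with effort := fun _ => y }
  have h := (hτ i d [] (by simp [IsHistory])).1
  have hoff : ∀ j h z, (Function.update (fun l => (τ l).toStrategy) i d j).offer h z =
      PMF.pure (keepAll j) := by
    intro j h z
    by_cases hj : j = i
    · subst hj; rw [Function.update_self]; exact hτ.offer_eq hk j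
    · rw [Function.update_of_ne hj]; exact hτ.offer_eq hk j
  have heff : (fun l => (Function.update (fun l => (τ l).toStrategy) i d l).effort []) =
      Function.update (fun l => (τ l).effort) i y := by
    funext l
    by_cases hl : l = i
    · subst hl; simp [d]
    · simp [Function.update_of_ne hl, StationaryStrategy.toStrategy]
  have hτp := hτ.payoff_eq hk hc hrec i
  rw [stationaryPayoff] at hτp
  rw [payoff_of_keepAll hk hoff hc hrec, hτp, EReal.coe_le_coe_iff, heff,
    Function.update_self] at h
  exact h

end Dictatorial
end Game
end Bargaining

end

/-! ### Assembly of the equilibrium and its uniqueness -/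

theorem theorem1 {n : ℕ} (hn : 2 ≤ n) (G : Bargaining.Game n)
    (hk1 : 1 ≤ G.k) (hkn : G.k ≤ n)
    (hα : ∀ i, 0 ≤ G.α i) (hβ : ∀ i, 0 ≤ G.β i)
    (hδ : ∀ i, 0 < G.δ i ∧ G.δ i < 1)
    (hf : ∀ i, Bargaining.IsTechnology (G.f i))
    (hc : ∀ i, Bargaining.IsEffortCost (G.c i))
    -- not exactly one agent who can compete, without any headstart
    (hcontest : ¬ ((∀ i, G.β i = 0) ∧ ∃! i, 0 < G.α i)) :
    ∃ (σ : Fin n → Bargaining.StationaryStrategy n) (x : Fin n → NNReal) (v : Fin n → ℝ)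
      (q : Fin n → PMF (Finset (Fin n))) (ψ : Fin n → Fin n → ℝ),
      G.IsSSPE σ ∧
      -- `v` is the profile of equilibrium expected payoffs
      (∀ i, G.stationaryPayoff σ i = (v i : EReal)) ∧
      -- each agent exerts effort `x i` in each period
      (∀ i, (σ i).effort = x i) ∧
      -- as the proposer, `i` draws a least costly winning coalition from `q i`, so that agent `j`
      -- is included with probability `ψ i j`, and offers `δ j * v j` to each member `j`
      (∀ i, ∀ C ∈ (q i).support, G.IsLeastCostCoalition v i C) ∧
      (∀ i j, j ≠ i → ψ i j = ∑ C : Finset (Fin n) with j ∈ C, (q i C).toReal) ∧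
      (∀ i, PMF.map (fun s : Bargaining.Proposal n => (s : Fin n → ℝ)) (σ i).offer =
        PMF.map (G.coalitionOffer v i) (q i)) ∧
      -- otherwise he accepts if and only if his share is at least `δ i * v i`
      G.VotesAsIfPivotal σ v ∧
      -- uniqueness under the dictatorial rule
      (G.k = 1 → ∀ τ : Fin n → Bargaining.StationaryStrategy n, G.IsSSPE τ →
        (∀ i, (τ i).effort = (σ i).effort) ∧ (∀ i, (τ i).offer = (σ i).offer) ∧
        (∀ i, G.stationaryPayoff τ i = (v i : EReal)) ∧
        (G.VotesAsIfPivotal τ v → ∀ i j, j ≠ i → (τ i).vote j = (σ i).vote j)) := by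
  obtain ⟨x, v, q, E⟩ := G.exists_equilibriumData (by omega) hk1 hkn hα hβ hδ hf hc hcontest
  have hc0 : ∀ i (y : NNReal), 0 ≤ G.c i y := fun i y => (hc i).nonneg y.coe_nonneg
  have hrec : ∀ y j, 0 ≤ G.recognition y j := Bargaining.Game.recognition_nonneg hα hβ hf
  have hδ0 : ∀ i, 0 < G.δ i := fun i => (hδ i).1
  let p : Fin n → PMF (Finset (Fin n)) := fun i =>
    PMF.ofFintype (fun C => ENNReal.ofReal (q i C)) (E.sum_ofReal i)
  have hp : ∀ i C, p i C = ENNReal.ofReal (q i C) := fun i C => rfl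
  have hσ : G.IsSSPE (G.equilibrium x v p) := E.isSSPE_equilibrium hp hδ0 hk1 hc0 hrec
  have hpay : ∀ i, G.stationaryPayoff (G.equilibrium x v p) i = (v i : EReal) := fun i =>
    E.payoff_equilibrium hp hδ0 hc0 hrec i []
  have hpiv : G.VotesAsIfPivotal (G.equilibrium x v p) v := fun i j _ s => by
    simp [Bargaining.Game.equilibrium]
  refine ⟨G.equilibrium x v p, x, v, p, fun i j => ∑ C : Finset (Fin n) with j ∈ C, (p i C).toReal,
    hσ, hpay, fun i => rfl, fun i C hC => E.leastCost_of_mem_support hp hC, fun i j _ => rfl,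
    fun i => ?_, hpiv, fun hk τ hτ => ?_⟩
  · change PMF.map _ ((p i).map (G.buy v i)) = _
    rw [PMF.map_comp]
    refine PMF.ext fun s => ?_
    rw [PMF.map_apply, PMF.map_apply]
    -- Only coalitions of positive probability matter, and on these `buy` is the coalition offer,
    -- not its default.
    refine tsum_congr fun C => ?_
    by_cases hC : p i C = 0
    · simp [hC]
    · rw [Function.comp_apply, E.coe_buy hp hδ0 hC]
  -- Contest equilibria depend only on recognition probabilities and costs, so the nondegenerate
  -- headstarts may replace the original ones in the uniqueness argument.
  · obtain ⟨β', hβ', hnd, hrec'⟩ :=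
      G.exists_nondegenerate_headstart hα hβ (by omega) hcontest
    have hcontest' : ∀ {y : Fin n → NNReal}, G.IsContestEquilibrium y →
        ({ G with β := β' } : Bargaining.Game n).IsContestEquilibrium y := by
      intro y hy i t
      rw [hrec', hrec']
      exact hy i t
    have heff : (fun l => (τ l).effort) = fun l => (G.equilibrium x v p l).effort :=
      Bargaining.Game.IsContestEquilibrium.eq (G := { G with β := β' }) hα hβ' hf hc hn hnd
        (hcontest' (hτ.isContestEquilibrium hk hc0 hrec))
        (hcontest' (hσ.isContestEquilibrium hk hc0 hrec))
    have heff' : ∀ i, (τ i).effort = (G.equilibrium x v p i).effort := fun i => congrFun heff i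
    refine ⟨heff', fun i => by rw [hτ.offer_eq hk, hσ.offer_eq hk], fun i => ?_,
      fun hτp i j hij => funext fun s => ?_⟩
    · rw [← hpay i, hτ.payoff_eq hk hc0 hrec, hσ.payoff_eq hk hc0 hrec, heff, heff' i]
    · rw [Bool.eq_iff_iff, hτp i j hij s, hpiv i j hij s]
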